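/- Let $\omega=(\sqrt5-1)/2$, let $(F_n)_{n\ge 0}=(0,1,1,2,3,5,8,\dots)$ be the Fibonacci sequence, and for $n\ge 0$ and real $x$ put $P_n(x)=\prod_{r=1}^{n}|2\sin\pi r x|$. Then the sequence $$Q_n=\Bigl|\prod_{r=1}^{F_n}2\sin\pi r\omega\Bigr|=P_{F_n}(\omega)$$ converges, as $n\to\infty$, to a finite positive constant $c=2.407\ldots$ (that is, $2.407\le c<2.408$). Moreover, for $n\ge1$ and integers $t\ge 0$ let $$s_{n,t}=2\sin\pi\left(\frac{t}{F_n}-\omega^n\left(\frac{[tF_{n-1}]}{F_n}-\frac12\right)\right),$$ where $[m]\in\{0,\dots,F_n-1\}$ denotes the residue of $m$ modulo $F_n$, and let $$A_n=2F_n\sin\pi\omega^n,\qquad B_n=\prod_{t=1}^{F_n-1}\frac{s_{n,t}}{2\sin(\pi t/F_n)},\qquad C_n=\prod_{1\le t\le F_n/2}\left(1-\frac{s_{n,0}^2}{s_{n,t}^2}\right)^{\varepsilon_{n,t}},$$ where $\varepsilon_{n,t}=\tfrac12$ if $2t=F_n$ and $\varepsilon_{n,t}=1$ otherwise (empty products are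 $1$). Then $Q_n=A_nB_nC_n$ for every $n\ge1$, $A_n\to 2\pi/\sqrt5$ as $n\to\infty$, and each of the sequences $B_n$ and $C_n$ converges to a finite, strictly positive limit. -/

import Mathlib

open Filter Topology

noncomputable section

namespace Sudler

/-- The golden rotation number `ω = (√5 - 1) / 2`. -/
def omega : ℝ := (Real.sqrt 5 - 1) / 2

/-- The Sudler product `P_n(x) = ∏_{r=1}^{n} |2 sin (π r x)|`. -/
def P (n : ℕ) (x : ℝ) : ℝ := ∏ r ∈ Finset.Icc 1 n, |2 * Real.sin (Real.pi * r * x)|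

/-- The Fibonacci decimation `Q_n = |∏_{r=1}^{F_n} 2 sin (π r ω)|`, where `F_0 = 0`, `F_1 = 1`. -/
def Q (n : ℕ) : ℝ := |∏ r ∈ Finset.Icc 1 (Nat.fib n), 2 * Real.sin (Real.pi * r * omega)|

/-- `s_{n,t} = 2 sin π (t / F_n - ω ^ n ([t F_{n-1}] / F_n - 1 / 2))` for `n ≥ 1`,
where `[·]` is the residue in `{0, …, F_n - 1}` modulo `F_n`. -/
def s (n t : ℕ) : ℝ :=
  2 * Real.sin (Real.pi * ((t : ℝ) / (Nat.fib n : ℝ)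
    - omega ^ n * (((t * Nat.fib (n - 1) % Nat.fib n : ℕ) : ℝ) / (Nat.fib n : ℝ) - 1 / 2)))

/-- `A_n = 2 F_n sin (π ω ^ n)`. -/
def A (n : ℕ) : ℝ := 2 * (Nat.fib n : ℝ) * Real.sin (Real.pi * omega ^ n)

/-- `B_n = ∏_{t=1}^{F_n - 1} s_{n,t} / (2 sin (π t / F_n))`. -/
def B (n : ℕ) : ℝ :=
  ∏ t ∈ Finset.Ico 1 (Nat.fib n), s n t / (2 * Real.sin (Real.pi * t / (Nat.fib n : ℝ)))

/-- `C_n = ∏_{t=1}^{F_n / 2} (1 - s_{n,0} ^ 2 / s_{n,t} ^ 2)`. This is half of the product over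
`1 ≤ t ≤ F_n - 1`, which is symmetric under `t ↦ F_n - t`: if `F_n` is even, the midpoint factor
`t = F_n / 2` enters with exponent `1 / 2`. -/
def C (n : ℕ) : ℝ :=
  ∏ t ∈ Finset.Icc 1 (Nat.fib n / 2),
    (1 - s n 0 ^ 2 / s n t ^ 2) ^ (if 2 * t = Nat.fib n then (1 / 2 : ℝ) else 1)

end Sudler

end

namespace Sudler

/-! Factorisation. Write q = F_{n+1}, p = F_n. Since p² ≡ ±1 mod q and ω is p/q up to ω^{n+1}/q,
visiting the indices r < q in the order r = tp mod q turns rω into ±(θ_t - ω^{n+1}/2) mod 1, where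
θ_t is the angle of s_{n+1,t} (`abs_sin_residue`). The reflection θ_{q-t} = 1 - θ_t makes the
products with shifts -ω^{n+1}/2 and +ω^{n+1}/2 equal, so the square of either one is ∏ (s_t² -
s_0²). This gives ∏ s_t times C; the index r = q and ∏ 2 sin(πt/q) = q give A and B
(`Q_eq_A_mul_B_mul_C`).

Convergence. The factors of C are 1 + O(1/t²), so dominated convergence applies. The logarithms of
the factors of B are -u_t k_t + O(1/t²) with u_t = {tp/q} - 1/2 and k_t → 1/(√5 t), so their linear
part converges only conditionally. Summation by parts handles it once |∑_{t≤N} u_t| ≤ 3√N is known.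
That bound comes from renormalisation: for α(1+β) = 1 the Birkhoff sums satisfy S_α(N) + S_β(⌊Nα⌋) =
g_β({Nα}) with g bounded (`S_add_S_floor`), and α ↦ β sends each convergent of ω to the preceding
one and fixes ω.

Value of the limit. The same Abel summation with ω itself shows that lim B·C is the infinite product
of explicit factors f(t) (`tendsto_G`). Its first 8192 factors are bounded in integer arithmetic.
The logarithm of the tail is -(2/√5) ∑ u_t/t up to O(1/N); with T the partial sums of u_t/t, the
combination T(N) + ωT(⌊Nω⌋) almost telescopes, so the tail of T is controlled by the finite
difference T(8192) - T(5062) (`tail_T_bounds`). -/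

/-! ### Arithmetic of ω and the Fibonacci numbers -/

lemma omega_eq_neg_goldenConj : omega = -Real.goldenConj := by
  unfold omega Real.goldenConj; ring

lemma omega_sq : omega ^ 2 = 1 - omega := by
  rw [omega_eq_neg_goldenConj, neg_sq, Real.goldenConj_sq]; ring

lemma omega_pos : 0 < omega := by
  rw [omega_eq_neg_goldenConj]; linarith [Real.goldenConj_neg]

lemma omega_lt_one : omega < 1 := by
  rw [omega_eq_neg_goldenConj]; linarith [Real.neg_one_lt_goldenConj]

lemma irrational_omega : Irrational omega := by
  rw [omega_eq_neg_goldenConj]; exact Real.goldenConj_irrational.neg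

lemma omega_gt : (0.618 : ℝ) < omega := by nlinarith [omega_sq, omega_pos]

lemma omega_lt : omega < (0.6181 : ℝ) := by nlinarith [omega_sq, omega_pos]

lemma sqrt_five_eq : Real.sqrt 5 = 1 + 2 * omega := by unfold omega; ring

lemma fib_succ_mul_omega (n : ℕ) :
    (Nat.fib (n + 1) : ℝ) * omega = Nat.fib n - (-omega) ^ (n + 1) := by
  rw [omega_eq_neg_goldenConj, neg_neg, ← Real.goldenConj_mul_fib_succ_add_fib]; ring

/-- As ω + ω² = 1, each ωⁿF_n is a convex combination of the two preceding ones, so the sequence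
stays between its first two values ω and ω². -/
lemma omega_pow_mul_fib_bounds (n : ℕ) :
    (omega ^ 2 ≤ omega ^ (n + 1) * Nat.fib (n + 1) ∧ omega ^ (n + 1) * Nat.fib (n + 1) ≤ omega) ∧
    (omega ^ 2 ≤ omega ^ (n + 2) * Nat.fib (n + 2) ∧
      omega ^ (n + 2) * Nat.fib (n + 2) ≤ omega) := by
  have h0 := omega_pos
  have h1 := omega_lt_one
  have h2 := omega_sq
  induction n with
  | zero => norm_num; nlinarith
  | succ n ih =>
    refine ⟨ih.2, ?_⟩
    have e : omega ^ (n + 3) * Nat.fib (n + 3) =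
        omega * (omega ^ (n + 2) * Nat.fib (n + 2)) +
          (1 - omega) * (omega ^ (n + 1) * Nat.fib (n + 1)) := by
      rw [Nat.fib_add_two (n := n + 1), ← h2]; push_cast; ring
    rw [show n + 1 + 2 = n + 3 from rfl, e]
    constructor <;> nlinarith [ih.1.1, ih.1.2, ih.2.1, ih.2.2]

lemma omega_pow_mul_fib_le (n : ℕ) : omega ^ (n + 1) * Nat.fib (n + 1) ≤ omega :=
  (omega_pow_mul_fib_bounds n).1.2

/-- Cassini's identity, arranged to display F_n² ≡ ±1 mod F_{n+1}. -/
lemma fib_cassini (n : ℕ) :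
    (Nat.fib n : ℤ) ^ 2 = (-1) ^ (n + 1) + Nat.fib (n + 1) * (Nat.fib (n + 1) - Nat.fib n) := by
  induction n with
  | zero => simp
  | succ n ih =>
    rw [Nat.fib_add_two, pow_succ]; push_cast; linear_combination -ih

/-! ### The exact factorisation Q = A B C -/

lemma abs_sin_pi_mul_add_int (y : ℝ) (m : ℤ) :
    |Real.sin (Real.pi * (y + m))| = |Real.sin (Real.pi * y)| := by
  rw [show Real.pi * (y + m) = Real.pi * y + m * Real.pi by ring, Real.sin_add_int_mul_pi, abs_mul]
  simp

/-- The angle (in units of `π`) of `s n t`. -/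
noncomputable def theta (n t : ℕ) : ℝ :=
  (t : ℝ) / Nat.fib n - omega ^ n * (((t * Nat.fib (n - 1) % Nat.fib n : ℕ) : ℝ) / Nat.fib n - 1 / 2)

lemma s_eq_theta (n t : ℕ) : s n t = 2 * Real.sin (Real.pi * theta n t) := rfl

lemma abs_sin_residue (n t : ℕ) :
    |2 * Real.sin (Real.pi * ((t * Nat.fib n % Nat.fib (n + 1) : ℕ) : ℝ) * omega)| =
      |2 * Real.sin (Real.pi * (theta (n + 1) t - omega ^ (n + 1) / 2))| := by
  set q := Nat.fib (n + 1) with hq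
  set p := Nat.fib n with hp
  have hq0 : (q : ℝ) ≠ 0 := by
    have : 0 < q := Nat.fib_pos.2 (Nat.succ_pos n)
    positivity
  set r := t * p % q with hr
  set k := t * p / q with hk
  have hrk : (r : ℝ) = t * p - q * k := by
    have := Nat.div_add_mod (t * p) q
    rw [← hr, ← hk] at this
    have h : (q : ℝ) * k + r = t * p := by exact_mod_cast this
    linarith
  have hc : (p : ℝ) ^ 2 = (-1) ^ (n + 1) + q * (q - p) := by exact_mod_cast fib_cassini n
  have hw := fib_succ_mul_omega n
  rw [← hq, ← hp] at hw
  set e : ℝ := (-1) ^ (n + 1) with he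
  have hw' : (-omega) ^ (n + 1) = e * omega ^ (n + 1) := by rw [neg_pow]
  have hth : theta (n + 1) t - omega ^ (n + 1) / 2 = t / q - omega ^ (n + 1) * (r / q) := by
    simp only [theta, Nat.add_sub_cancel, ← hq, ← hp, ← hr]; ring
  -- Substitute ω = (p - e ω^{n+1})/q; by Cassini rp = te + q(t(q-p) - kp), so rp/q is e·t/q plus an
  -- integer.
  have key : (r : ℝ) * omega =
      e * (t / q - omega ^ (n + 1) * (r / q)) + ((t * (q - p) - k * p : ℤ) : ℝ) := by
    have : omega = (p - e * omega ^ (n + 1)) / q := by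
      rw [← hw']; field_simp; linarith
    rw [show (r : ℝ) * omega = r * ((p - e * omega ^ (n + 1)) / q) by rw [← this]]
    push_cast
    field_simp
    have h2 : (r : ℝ) * p = t * (e + q * (q - p)) - q * k * p := by
      rw [← hc, hrk]; ring
    linear_combination h2
  rw [mul_assoc, key, hth, abs_mul, abs_mul, abs_sin_pi_mul_add_int]
  rcases neg_one_pow_eq_or ℝ (n + 1) with h | h <;> rw [he, h]
  · rw [one_mul]
  · rw [show Real.pi * (-1 * (t / q - omega ^ (n + 1) * (r / q))) =
      -(Real.pi * (t / q - omega ^ (n + 1) * (r / q))) by ring, Real.sin_neg, abs_neg]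

lemma prod_Ico_mul_mod {p q : ℕ} (h : Nat.Coprime p q) (f : ℕ → ℝ) :
    ∏ t ∈ Finset.Ico 1 q, f (t * p % q) = ∏ r ∈ Finset.Ico 1 q, f r := by
  have hinj : Set.InjOn (fun t => t * p % q) (Finset.Ico 1 q : Finset ℕ) := by
    intro a ha b hb hab
    rw [Finset.mem_coe, Finset.mem_Ico] at ha hb
    have h1 : a * p ≡ b * p [MOD q] := hab
    have h2 := Nat.ModEq.cancel_right_of_coprime (by rwa [Nat.Coprime, Nat.gcd_comm] at h) h1
    exact Nat.ModEq.eq_of_lt_of_lt h2 ha.2 hb.2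
  have himg : (Finset.Ico 1 q).image (fun t => t * p % q) = Finset.Ico 1 q := by
    apply Finset.eq_of_subset_of_card_le
    · intro x hx
      obtain ⟨t, ht, rfl⟩ := Finset.mem_image.1 hx
      rw [Finset.mem_Ico] at ht ⊢
      refine ⟨Nat.one_le_iff_ne_zero.2 fun h0 => ?_, Nat.mod_lt _ (by omega)⟩
      have h1 : q ∣ t := (Nat.Coprime.dvd_of_dvd_mul_right h.symm (Nat.dvd_of_mod_eq_zero h0))
      exact absurd (Nat.le_of_dvd (by omega) h1) (by omega)
    · rw [Finset.card_image_of_injOn hinj]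
  conv_rhs => rw [← himg]
  rw [Finset.prod_image hinj]

/-- Absolute values in ∏ (1 - ζ^k) = q for a primitive q-th root of unity ζ. -/
lemma prod_two_mul_sin (q : ℕ) (hq : 0 < q) :
    ∏ t ∈ Finset.Ico 1 q, (2 * Real.sin (Real.pi * t / q)) = q := by
  obtain ⟨n, rfl⟩ : ∃ n, q = n + 1 := ⟨q - 1, by omega⟩
  have hμ := Complex.isPrimitiveRoot_exp (n + 1) (Nat.succ_ne_zero n)
  have h := congrArg (fun z : ℂ => ‖z‖) hμ.prod_one_sub_pow_eq_order
  simp only [norm_prod] at h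
  rw [Finset.prod_Ico_eq_prod_range, show n + 1 - 1 = n from rfl]
  have hn : ‖((n : ℂ) + 1)‖ = ((n + 1 : ℕ) : ℝ) := by
    rw [← Nat.cast_succ, Complex.norm_natCast]
  rw [hn] at h
  refine Eq.trans ?_ h
  refine Finset.prod_congr rfl fun k hk => ?_
  have hk' : k < n := Finset.mem_range.1 hk
  have hs : 0 ≤ Real.sin (Real.pi * ((1 + k : ℕ) : ℝ) / ((n + 1 : ℕ) : ℝ)) := by
    apply Real.sin_nonneg_of_nonneg_of_le_pi
    · positivity
    · rw [div_le_iff₀ (by positivity)]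
      have : (k : ℝ) < n := by exact_mod_cast hk'
      push_cast
      nlinarith [Real.pi_pos]
  rw [← Complex.exp_nat_mul, show (((k + 1 : ℕ) : ℂ) * (2 * Real.pi * Complex.I / ((n + 1 : ℕ) : ℂ)))
    = Complex.I * ((2 * (Real.pi * ((1 + k : ℕ) : ℝ) / ((n + 1 : ℕ) : ℝ)) : ℝ) : ℂ) by
      push_cast; ring]
  rw [norm_sub_rev, Complex.norm_exp_I_mul_ofReal_sub_one, mul_div_cancel_left₀ _ two_ne_zero,
    Real.norm_eq_abs, abs_of_nonneg (by positivity)]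


lemma fib_succ_pos_real (n : ℕ) : (0 : ℝ) < Nat.fib (n + 1) := by
  exact_mod_cast Nat.fib_pos.2 (Nat.succ_pos n)

lemma theta_zero (n : ℕ) : theta n 0 = omega ^ n / 2 := by
  simp [theta]; ring

/-- The perturbation is smaller than the grid spacing, so perturbed angles stay inside (0, 1) and
all the sines are positive. -/
lemma omega_pow_lt_inv_fib (n : ℕ) : omega ^ (n + 1) < 1 / Nat.fib (n + 1) := by
  rw [lt_div_iff₀ (fib_succ_pos_real n)]
  exact (omega_pow_mul_fib_le n).trans_lt omega_lt_one

lemma theta_sub_pos (n t : ℕ) (ht : 1 ≤ t) :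
    0 < theta (n + 1) t - omega ^ (n + 1) / 2 := by
  have hq := fib_succ_pos_real n
  have ha := omega_pow_lt_inv_fib n
  have ha0 : 0 < omega ^ (n + 1) := pow_pos omega_pos _
  have hr : ((t * Nat.fib n % Nat.fib (n + 1) : ℕ) : ℝ) / Nat.fib (n + 1) ≤ 1 := by
    rw [div_le_one hq]
    exact_mod_cast (Nat.mod_lt _ (Nat.fib_pos.2 (Nat.succ_pos n))).le
  have ht' : (1 : ℝ) / Nat.fib (n + 1) ≤ t / Nat.fib (n + 1) := by
    gcongr; exact_mod_cast ht
  simp only [theta, Nat.add_sub_cancel]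
  nlinarith

lemma theta_add_lt_one (n t : ℕ) (ht : t < Nat.fib (n + 1)) :
    theta (n + 1) t + omega ^ (n + 1) / 2 < 1 := by
  have hq := fib_succ_pos_real n
  have ha := omega_pow_lt_inv_fib n
  have ha0 : 0 < omega ^ (n + 1) := pow_pos omega_pos _
  have hr : 0 ≤ ((t * Nat.fib n % Nat.fib (n + 1) : ℕ) : ℝ) / Nat.fib (n + 1) := by positivity
  have ht' : (t : ℝ) / Nat.fib (n + 1) ≤ 1 - 1 / Nat.fib (n + 1) := by
    have h : (t : ℝ) + 1 ≤ Nat.fib (n + 1) := by exact_mod_cast ht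
    rw [le_sub_iff_add_le, ← add_div, div_le_one hq]
    exact h
  simp only [theta, Nat.add_sub_cancel]
  nlinarith

/-- Replacing t by q - t replaces the residue r by q - r, and r/q - 1/2 is odd under this. The
centring by 1/2 is there for this symmetry. -/
lemma theta_reflect (n t : ℕ) (ht : 1 ≤ t) (ht' : t < Nat.fib (n + 1)) :
    theta (n + 1) (Nat.fib (n + 1) - t) = 1 - theta (n + 1) t := by
  have hq := fib_succ_pos_real n
  set q := Nat.fib (n + 1) with hqd
  set p := Nat.fib n with hp
  have hcop : Nat.Coprime q p := (Nat.fib_coprime_fib_succ n).symm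
  have hr0 : t * p % q ≠ 0 := fun h0 => by
    have h1 := Nat.le_of_dvd (by omega) (hcop.dvd_of_dvd_mul_right (Nat.dvd_of_mod_eq_zero h0))
    omega
  have hrlt : t * p % q < q := Nat.mod_lt _ (by omega)
  have hmod : (q - t) * p % q = q - t * p % q := by
    have h1 : (q - t) * p + t * p = q * p := by rw [← Nat.add_mul, Nat.sub_add_cancel ht'.le]
    have h2 : ((q - t) * p + t * p % q) % q = 0 := by
      rw [Nat.add_mod_mod, h1, Nat.mul_mod_right]
    have h3 := Nat.mod_lt ((q - t) * p) (by omega : 0 < q)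
    rw [Nat.add_mod, Nat.mod_mod] at h2
    obtain ⟨c, hc⟩ := Nat.dvd_of_mod_eq_zero h2
    have hc1 : c = 1 := by
      have : 0 < c := by
        rcases Nat.eq_zero_or_pos c with h | h
        · subst h; omega
        · exact h
      have : c < 2 := by
        by_contra hge
        have : q * 2 ≤ q * c := Nat.mul_le_mul_left _ (by omega)
        omega
      omega
    subst hc1
    omega
  simp only [theta, Nat.add_sub_cancel, ← hqd, ← hp, hmod]
  rw [Nat.cast_sub ht'.le, Nat.cast_sub hrlt.le]
  field_simp
  ring

lemma s_pos (n t : ℕ) (ht : 1 ≤ t) (ht' : t < Nat.fib (n + 1)) : 0 < s (n + 1) t := by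
  have h1 := theta_sub_pos n t ht
  have h2 := theta_add_lt_one n t ht'
  have ha0 : 0 < omega ^ (n + 1) := pow_pos omega_pos _
  rw [s_eq_theta]
  refine mul_pos two_pos (Real.sin_pos_of_pos_of_lt_pi ?_ ?_)
  · exact mul_pos Real.pi_pos (by linarith)
  · nlinarith [Real.pi_pos]

lemma s_reflect (n t : ℕ) (ht : 1 ≤ t) (ht' : t < Nat.fib (n + 1)) :
    s (n + 1) (Nat.fib (n + 1) - t) = s (n + 1) t := by
  rw [s_eq_theta, s_eq_theta, theta_reflect n t ht ht', mul_sub, mul_one, Real.sin_pi_sub]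

lemma shifted_sin_pos (n t : ℕ) (ht : 1 ≤ t) (ht' : t < Nat.fib (n + 1)) :
    0 < 2 * Real.sin (Real.pi * (theta (n + 1) t - omega ^ (n + 1) / 2)) ∧
    0 < 2 * Real.sin (Real.pi * (theta (n + 1) t + omega ^ (n + 1) / 2)) := by
  have h1 := theta_sub_pos n t ht
  have h2 := theta_add_lt_one n t ht'
  have ha0 : 0 < omega ^ (n + 1) := pow_pos omega_pos _
  refine ⟨mul_pos two_pos (Real.sin_pos_of_pos_of_lt_pi ?_ ?_),
    mul_pos two_pos (Real.sin_pos_of_pos_of_lt_pi ?_ ?_)⟩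
  · exact mul_pos Real.pi_pos (by linarith)
  · nlinarith [Real.pi_pos]
  · exact mul_pos Real.pi_pos (by linarith)
  · nlinarith [Real.pi_pos]

lemma shifted_sin_mul (n t : ℕ) :
    (2 * Real.sin (Real.pi * (theta n t - omega ^ n / 2))) *
      (2 * Real.sin (Real.pi * (theta n t + omega ^ n / 2))) = s n t ^ 2 - s n 0 ^ 2 := by
  rw [s_eq_theta, s_eq_theta, theta_zero, mul_sub, mul_add, Real.sin_sub, Real.sin_add]
  have h1 := Real.sin_sq_add_cos_sq (Real.pi * theta n t)
  have h2 := Real.sin_sq_add_cos_sq (Real.pi * (omega ^ n / 2))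
  set a := Real.sin (Real.pi * theta n t)
  set b := Real.cos (Real.pi * theta n t)
  set c := Real.sin (Real.pi * (omega ^ n / 2))
  set d := Real.cos (Real.pi * (omega ^ n / 2))
  linear_combination 4 * a ^ 2 * h2 - 4 * c ^ 2 * h1

lemma one_sub_s_ratio_pos (n t : ℕ) (ht : 1 ≤ t) (ht' : t < Nat.fib (n + 1)) :
    0 < 1 - s (n + 1) 0 ^ 2 / s (n + 1) t ^ 2 := by
  have h1 := shifted_sin_pos n t ht ht'
  have h2 := s_pos n t ht ht'
  rw [sub_pos, div_lt_one (by positivity)]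
  have := mul_pos h1.1 h1.2
  rw [shifted_sin_mul] at this
  linarith

/-- Pair t with q - t. For even q the midpoint is its own partner and occurs once, hence the
exponent 1/2. -/
lemma prod_Ico_eq_sq_of_reflect (q : ℕ) (f : ℕ → ℝ) (hpos : ∀ t, 1 ≤ t → t < q → 0 < f t)
    (hf : ∀ t, 1 ≤ t → t < q → f (q - t) = f t) :
    ∏ t ∈ Finset.Ico 1 q, f t =
      (∏ t ∈ Finset.Icc 1 (q / 2), f t ^ (if 2 * t = q then (1 / 2 : ℝ) else 1)) ^ 2 := by
  rcases Nat.eq_zero_or_pos q with rfl | hq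
  · simp
  set L := Finset.Ico 1 ((q + 1) / 2) with hL
  have hlow : ∀ t ∈ L, 1 ≤ t ∧ 2 * t < q := fun t ht => by
    rw [hL, Finset.mem_Ico] at ht; omega
  have hrefl : ∏ t ∈ Finset.Ico (q / 2 + 1) q, f t = ∏ t ∈ L, f t := by
    refine Finset.prod_nbij' (fun t => q - t) (fun t => q - t) ?_ ?_ ?_ ?_ ?_
    · intro t ht; simp only [hL, Finset.mem_Ico] at ht ⊢; omega
    · intro t ht; simp only [hL, Finset.mem_Ico] at ht ⊢; omega
    · intro t ht; simp only [Finset.mem_Ico] at ht ⊢; omega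
    · intro t ht; simp only [hL, Finset.mem_Ico] at ht ⊢; omega
    · intro t ht
      simp only [Finset.mem_Ico] at ht
      exact (hf t (by omega) ht.2).symm
  have hLp : ∏ t ∈ L, f t ^ (if 2 * t = q then (1 / 2 : ℝ) else 1) = ∏ t ∈ L, f t := by
    refine Finset.prod_congr rfl fun t ht => ?_
    have := hlow t ht
    rw [if_neg (by omega), Real.rpow_one]
  rcases Nat.even_or_odd' q with ⟨k, hk | hk⟩
  · have e1 : Finset.Icc 1 (q / 2) = Finset.Ico 1 (k + 1) := by
      ext t; simp only [Finset.mem_Icc, Finset.mem_Ico]; omega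
    have e2 : L = Finset.Ico 1 k := by
      rw [hL]; congr 1; omega
    rw [e1, Finset.prod_Ico_succ_top (by omega), ← e2, hLp, if_pos hk.symm,
      ← Finset.prod_Ico_consecutive f (show 1 ≤ q / 2 + 1 by omega) (show q / 2 + 1 ≤ q by omega),
      hrefl, show q / 2 + 1 = k + 1 by omega, Finset.prod_Ico_succ_top (by omega), ← e2, mul_pow,
      ← Real.rpow_natCast (f k ^ (1 / 2 : ℝ)), ← Real.rpow_mul (hpos k (by omega) (by omega)).le]
    norm_num
    ring
  · have e1 : Finset.Icc 1 (q / 2) = L := by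
      ext t; simp only [hL, Finset.mem_Icc, Finset.mem_Ico]; omega
    have e2 : Finset.Ico 1 (q / 2 + 1) = L := by
      ext t; simp only [hL, Finset.mem_Ico]; omega
    rw [e1, hLp,
      ← Finset.prod_Ico_consecutive f (show 1 ≤ q / 2 + 1 by omega) (show q / 2 + 1 ≤ q by omega),
      hrefl, e2, sq]

lemma C_pos (n : ℕ) : 0 < C (n + 1) := by
  refine Finset.prod_pos fun t ht => Real.rpow_pos_of_pos ?_ _
  rw [Finset.mem_Icc] at ht
  exact one_sub_s_ratio_pos n t ht.1 (by omega)

lemma prod_shifted_sin (n : ℕ) :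
    ∏ t ∈ Finset.Ico 1 (Nat.fib (n + 1)),
      (2 * Real.sin (Real.pi * (theta (n + 1) t - omega ^ (n + 1) / 2))) =
      (∏ t ∈ Finset.Ico 1 (Nat.fib (n + 1)), s (n + 1) t) * C (n + 1) := by
  set q := Nat.fib (n + 1) with hq
  set Xm := fun t => 2 * Real.sin (Real.pi * (theta (n + 1) t - omega ^ (n + 1) / 2)) with hXm
  set Xp := fun t => 2 * Real.sin (Real.pi * (theta (n + 1) t + omega ^ (n + 1) / 2)) with hXp
  have hmp : ∏ t ∈ Finset.Ico 1 q, Xp t = ∏ t ∈ Finset.Ico 1 q, Xm t := by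
    refine Finset.prod_nbij' (fun t => q - t) (fun t => q - t) ?_ ?_ ?_ ?_ ?_
    · intro t ht; simp only [Finset.mem_Ico] at ht ⊢; omega
    · intro t ht; simp only [Finset.mem_Ico] at ht ⊢; omega
    · intro t ht; simp only [Finset.mem_Ico] at ht ⊢; omega
    · intro t ht; simp only [Finset.mem_Ico] at ht ⊢; omega
    · intro t ht
      simp only [Finset.mem_Ico] at ht
      simp only [hXm, hXp]
      rw [theta_reflect n t ht.1 ht.2, ← Real.sin_pi_sub]
      congr 2; ring
  have hsq : (∏ t ∈ Finset.Ico 1 q, Xm t) ^ 2 =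
      ((∏ t ∈ Finset.Ico 1 q, s (n + 1) t) * C (n + 1)) ^ 2 := by
    have hC := prod_Ico_eq_sq_of_reflect q (fun t => 1 - s (n + 1) 0 ^ 2 / s (n + 1) t ^ 2)
      (fun t h1 h2 => one_sub_s_ratio_pos n t h1 h2)
      (fun t h1 h2 => by simp only [hq, s_reflect n t h1 h2])
    rw [mul_pow, C, ← hC, sq]
    -- One copy of the minus product becomes the plus product, so that the factors pair up as s_t² -
    -- s_0².
    nth_rw 2 [← hmp]
    rw [← Finset.prod_mul_distrib, ← Finset.prod_pow, ← Finset.prod_mul_distrib]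
    refine Finset.prod_congr rfl fun t ht => ?_
    rw [Finset.mem_Ico] at ht
    have := (s_pos n t ht.1 ht.2).ne'
    simp only [hXm, hXp]
    rw [shifted_sin_mul]
    field_simp
  refine (pow_left_inj₀ ?_ ?_ two_ne_zero).1 hsq
  · refine Finset.prod_nonneg fun t ht => ?_
    rw [Finset.mem_Ico] at ht
    exact (shifted_sin_pos n t ht.1 ht.2).1.le
  · refine mul_nonneg (Finset.prod_nonneg fun t ht => ?_) (C_pos n).le
    rw [Finset.mem_Ico] at ht
    exact (s_pos n t ht.1 ht.2).le

theorem Q_eq_A_mul_B_mul_C (n : ℕ) : Q (n + 1) = A (n + 1) * B (n + 1) * C (n + 1) := by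
  set q := Nat.fib (n + 1) with hq
  have hq0 : 0 < q := Nat.fib_pos.2 (Nat.succ_pos n)
  have hqr : (0 : ℝ) < q := by exact_mod_cast hq0
  have hlast : |2 * Real.sin (Real.pi * (q : ℝ) * omega)| =
      2 * Real.sin (Real.pi * omega ^ (n + 1)) := by
    have h1 : (0 : ℝ) < omega ^ (n + 1) := pow_pos omega_pos _
    have h2 : omega ^ (n + 1) < 1 := pow_lt_one₀ omega_pos.le omega_lt_one (by omega)
    have h3 : 0 < Real.sin (Real.pi * omega ^ (n + 1)) :=
      Real.sin_pos_of_pos_of_lt_pi (mul_pos Real.pi_pos h1) (by nlinarith [Real.pi_pos])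
    have h4 := fib_succ_mul_omega n
    rw [mul_assoc, h4, neg_pow, abs_mul, abs_two, show (Nat.fib n : ℝ) - (-1) ^ (n + 1) *
      omega ^ (n + 1) = -((-1) ^ (n + 1) * omega ^ (n + 1)) + ((Nat.fib n : ℤ) : ℝ) by
        push_cast; ring, abs_sin_pi_mul_add_int, mul_neg, Real.sin_neg, abs_neg]
    rcases neg_one_pow_eq_or ℝ (n + 1) with h | h <;> rw [h]
    · rw [one_mul, abs_of_pos h3]
    · rw [neg_one_mul, mul_neg, Real.sin_neg, abs_neg, abs_of_pos h3]
  have hQ : Q (n + 1) = (∏ t ∈ Finset.Ico 1 q,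
      (2 * Real.sin (Real.pi * (theta (n + 1) t - omega ^ (n + 1) / 2)))) *
      (2 * Real.sin (Real.pi * omega ^ (n + 1))) := by
    rw [Q, Finset.abs_prod, ← hq, show Finset.Icc 1 q = Finset.Ico 1 (q + 1) from rfl,
      Finset.prod_Ico_succ_top (by omega), hlast]
    congr 1
    rw [← prod_Ico_mul_mod (Nat.fib_coprime_fib_succ n)
      (fun r => |2 * Real.sin (Real.pi * (r : ℝ) * omega)|)]
    refine Finset.prod_congr rfl fun t ht => ?_
    rw [Finset.mem_Ico] at ht
    rw [abs_sin_residue, abs_of_pos (shifted_sin_pos n t ht.1 ht.2).1]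
  rw [hQ, prod_shifted_sin, A, B, Finset.prod_div_distrib, ← hq, prod_two_mul_sin q hq0]
  field_simp


/-! ### Birkhoff sums and their renormalisation -/

/-- The centred fractional part `{t α} - 1/2`. -/
noncomputable def u (α : ℝ) (t : ℕ) : ℝ := Int.fract (t * α) - 1 / 2

/-- The Birkhoff sum `∑_{t=1}^{N} ({t α} - 1/2)`. -/
noncomputable def S (α : ℝ) (N : ℕ) : ℝ := ∑ t ∈ Finset.range N, u α (t + 1)

/-- The coboundary linking the Birkhoff sums of `α` and of `β = 1/α - 1`. -/
noncomputable def g (β x : ℝ) : ℝ := ((1 + β) * x ^ 2 - β * x) / 2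

lemma abs_u_le (α : ℝ) (t : ℕ) : |u α t| ≤ 1 / 2 := by
  unfold u
  rw [abs_le]
  constructor <;> linarith [Int.fract_nonneg (t * α), Int.fract_lt_one (t * α)]

lemma fract_eq_sub_natFloor {a : ℝ} (ha : 0 ≤ a) : Int.fract a = a - ⌊a⌋₊ := by
  rw [← Int.self_sub_floor, natCast_floor_eq_intCast_floor ha]

/-- The quadratic g satisfies g(x+α) - g(x) = x + α - 1/2. When the rotation wraps around to y, the
defect is exactly one term of the β-sum, because {(M+1)β} = 1 - y/α; this needs y ≠ 0. -/
lemma g_step {α β : ℝ} (hα0 : 0 < α) (hα1 : α < 1) (h : α * (1 + β) = 1) (N : ℕ)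
    (hx : Int.fract (((N + 1 : ℕ) : ℝ) * α) ≠ 0) :
    (⌊((N + 1 : ℕ) : ℝ) * α⌋₊ = ⌊(N : ℝ) * α⌋₊ ∧
      g β (Int.fract (((N + 1 : ℕ) : ℝ) * α)) - g β (Int.fract ((N : ℝ) * α)) = u α (N + 1)) ∨
    (⌊((N + 1 : ℕ) : ℝ) * α⌋₊ = ⌊(N : ℝ) * α⌋₊ + 1 ∧
      g β (Int.fract (((N + 1 : ℕ) : ℝ) * α)) - g β (Int.fract ((N : ℝ) * α)) =
        u α (N + 1) + u β (⌊(N : ℝ) * α⌋₊ + 1)) := by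
  have hN0 : 0 ≤ (N : ℝ) * α := by positivity
  have hN1 : 0 ≤ ((N + 1 : ℕ) : ℝ) * α := by positivity
  have e0 := fract_eq_sub_natFloor hN0
  have e1 := fract_eq_sub_natFloor hN1
  have hx0 := Int.fract_nonneg ((N : ℝ) * α)
  have hx1 := Int.fract_lt_one ((N : ℝ) * α)
  have hy0 : 0 < Int.fract (((N + 1 : ℕ) : ℝ) * α) :=
    lt_of_le_of_ne (Int.fract_nonneg _) hx.symm
  have hy1 := Int.fract_lt_one (((N + 1 : ℕ) : ℝ) * α)
  unfold u
  set x := Int.fract ((N : ℝ) * α)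
  set y := Int.fract (((N + 1 : ℕ) : ℝ) * α)
  set M := ⌊(N : ℝ) * α⌋₊
  set M' := ⌊((N + 1 : ℕ) : ℝ) * α⌋₊
  push_cast at e1
  have hM1 : M ≤ M' := Nat.floor_mono (by push_cast; nlinarith)
  have hM2 : M' < M + 2 := by
    have : (M' : ℝ) < M + 2 := by nlinarith
    exact_mod_cast this
  have hα : α ≠ 0 := hα0.ne'
  have hβ : β = 1 / α - 1 := by field_simp; linarith
  rcases (show M' = M ∨ M' = M + 1 by omega) with hM | hM
  · left
    refine ⟨hM, ?_⟩
    have hy : y = x + α := by rw [e1, e0, hM]; ring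
    rw [hy, g, g, hβ]
    field_simp
    ring
  · right
    refine ⟨hM, ?_⟩
    have hy : y = x + α - 1 := by rw [e1, e0, hM]; push_cast; ring
    have hyα : y < α := by linarith
    have hyd : y / α < 1 := (div_lt_one hα0).2 hyα
    have hyd0 : 0 < y / α := by positivity
    have hf : Int.fract (((M + 1 : ℕ) : ℝ) * β) = 1 - y / α := by
      rw [Int.fract_eq_iff]
      refine ⟨by linarith, by linarith, (N : ℤ) - M - 1, ?_⟩
      have hM' : (M : ℝ) = (N + 1) * α - 1 - y := by rw [e1, hM]; push_cast; ring
      rw [hβ]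
      push_cast
      rw [hM']
      field_simp
      ring
    rw [hf, hy, g, g, hβ]
    field_simp
    ring

lemma S_succ (α : ℝ) (N : ℕ) : S α (N + 1) = S α N + u α (N + 1) := Finset.sum_range_succ _ _

lemma S_zero (α : ℝ) : S α 0 = 0 := Finset.sum_range_zero _

lemma S_add_S_floor {α β : ℝ} (hα0 : 0 < α) (hα1 : α < 1) (h : α * (1 + β) = 1) (N : ℕ)
    (hx : ∀ k : ℕ, 1 ≤ k → k ≤ N → Int.fract ((k : ℝ) * α) ≠ 0) :
    S α N + S β ⌊(N : ℝ) * α⌋₊ = g β (Int.fract ((N : ℝ) * α)) := by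
  induction N with
  | zero => simp [S_zero, g]
  | succ N ih =>
    have ih' := ih fun k h1 h2 => hx k h1 (by omega)
    rcases g_step hα0 hα1 h N (hx (N + 1) (by omega) le_rfl) with ⟨hM, hg⟩ | ⟨hM, hg⟩
    · rw [hM, S_succ]; linarith
    · rw [hM, S_succ, S_succ]; linarith

lemma g_le_half {β x : ℝ} (hβ : 0 ≤ β) (h0 : 0 ≤ x) (h1 : x ≤ 1) : g β x ≤ 1 / 2 := by
  unfold g
  nlinarith [mul_nonneg (sub_nonneg.2 h1) h0, mul_nonneg hβ (mul_nonneg (sub_nonneg.2 h1) h0)]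

lemma g_ge {β x : ℝ} (hβ : 0 ≤ β) : -(β / 8) ≤ g β x := by
  unfold g
  nlinarith [mul_nonneg hβ (sq_nonneg (x - 1 / 2)), sq_nonneg x]

lemma abs_S_le_step {α β : ℝ} (hα0 : 1 / 2 ≤ α) (hα1 : α ≤ 2 / 3) (h : α * (1 + β) = 1) (N : ℕ)
    (hx : ∀ k : ℕ, 1 ≤ k → k ≤ N → Int.fract ((k : ℝ) * α) ≠ 0)
    (hS : |S β ⌊(N : ℝ) * α⌋₊| ≤ 3 * Real.sqrt ⌊(N : ℝ) * α⌋₊) :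
    |S α N| ≤ 3 * Real.sqrt N := by
  rcases Nat.eq_zero_or_pos N with rfl | hN
  · simp [S_zero]
  have hN1 : (1 : ℝ) ≤ N := by exact_mod_cast hN
  have hβ0 : 0 ≤ β := by nlinarith
  have hβ1 : β ≤ 1 := by nlinarith
  have hrec := S_add_S_floor (by linarith) (by linarith) h N hx
  have hg1 : g β (Int.fract ((N : ℝ) * α)) ≤ 1 / 2 :=
    g_le_half hβ0 (Int.fract_nonneg _) (Int.fract_lt_one _).le
  have hg2 := g_ge (x := Int.fract ((N : ℝ) * α)) hβ0
  have hfl : (⌊(N : ℝ) * α⌋₊ : ℝ) ≤ N * α := Nat.floor_le (by positivity)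
  have hs1 : 1 ≤ Real.sqrt N := Real.one_le_sqrt.2 hN1
  -- 0.82² > 2/3 ≥ α, and 1/2 + 3·0.82 < 3 closes the induction.
  have hs2 : Real.sqrt ⌊(N : ℝ) * α⌋₊ ≤ 0.82 * Real.sqrt N := by
    rw [show (0.82 : ℝ) * Real.sqrt N = Real.sqrt (0.82 ^ 2 * N) by
      rw [Real.sqrt_mul (by norm_num), Real.sqrt_sq (by norm_num)]]
    apply Real.sqrt_le_sqrt
    nlinarith
  rw [abs_le] at hS ⊢
  constructor <;> linarith

/-- The convergents `F_n / F_{n+1}` of `ω`. -/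
noncomputable def conv (n : ℕ) : ℝ := (Nat.fib n : ℝ) / Nat.fib (n + 1)

lemma natCast_mul_conv (n t : ℕ) :
    (t : ℝ) * conv n = ((t * Nat.fib n : ℕ) : ℝ) / ((Nat.fib (n + 1) : ℕ) : ℝ) := by
  unfold conv; push_cast; ring

lemma fract_mul_conv (n t : ℕ) : Int.fract ((t : ℝ) * conv n) =
    ((t * Nat.fib n % Nat.fib (n + 1) : ℕ) : ℝ) / Nat.fib (n + 1) := by
  rw [natCast_mul_conv, Int.fract_div_natCast_eq_div_natCast_mod]

lemma fract_mul_conv_ne_zero (n t : ℕ) (h1 : 1 ≤ t) (h2 : t < Nat.fib (n + 1)) :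
    Int.fract ((t : ℝ) * conv n) ≠ 0 := by
  rw [fract_mul_conv]
  refine div_ne_zero (Nat.cast_ne_zero.2 fun h0 => ?_) (fib_succ_pos_real n).ne'
  have hcop : Nat.Coprime (Nat.fib (n + 1)) (Nat.fib n) := (Nat.fib_coprime_fib_succ n).symm
  exact absurd (Nat.le_of_dvd (by omega) (hcop.dvd_of_dvd_mul_right (Nat.dvd_of_mod_eq_zero h0)))
    (by omega)

/-- Induction along the convergents: 1/α - 1 sends F_n/F_{n+1} to F_{n-1}/F_n. The restriction on N
keeps the orbit away from 0 and is inherited by the floor. -/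
lemma abs_S_conv_le (n N : ℕ) (hN : N < Nat.fib (n + 1)) : |S (conv n) N| ≤ 3 * Real.sqrt N := by
  induction n using Nat.strong_induction_on generalizing N with
  | _ n ih =>
    rcases (show n = 0 ∨ n = 1 ∨ ∃ k, n = k + 2 by
      rcases n with _ | _ | k <;> simp) with rfl | rfl | ⟨k, rfl⟩
    · have : N = 0 := by simpa using hN
      simp [this, S_zero]
    · have : N = 0 := by simpa using hN
      simp [this, S_zero]
    · have h1 := fib_succ_pos_real k
      have h2 := fib_succ_pos_real (k + 1)
      have h3 := fib_succ_pos_real (k + 2)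
      have e2 : (Nat.fib (k + 2) : ℝ) = Nat.fib k + Nat.fib (k + 1) := by
        exact_mod_cast Nat.fib_add_two
      have e3 : (Nat.fib (k + 2 + 1) : ℝ) = Nat.fib (k + 1) + Nat.fib (k + 2) := by
        exact_mod_cast Nat.fib_add_two (n := k + 1)
      have hk : (Nat.fib k : ℝ) ≤ Nat.fib (k + 1) := by exact_mod_cast Nat.fib_le_fib_succ
      have hk0 : (0 : ℝ) ≤ Nat.fib k := by positivity
      refine abs_S_le_step (β := conv (k + 1)) ?_ ?_ ?_ N
        (fun t ht1 ht2 => fract_mul_conv_ne_zero _ _ ht1 (by omega)) (ih (k + 1) (by omega) _ ?_)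
      · unfold conv; rw [div_le_div_iff₀ two_pos h3]; linarith
      · unfold conv; rw [div_le_div_iff₀ h3 (by norm_num)]; linarith
      · unfold conv
        rw [e3]
        rw [e3] at h3
        have h2' : (Nat.fib (k + 1 + 1) : ℝ) ≠ 0 := h2.ne'
        have h3' := h3.ne'
        field_simp
        ring
      · rw [Nat.floor_lt (by unfold conv; positivity), natCast_mul_conv, div_lt_iff₀ h3]
        have hN' : (N : ℝ) < Nat.fib (k + 2 + 1) := by exact_mod_cast hN
        push_cast
        nlinarith

lemma fract_mul_omega_ne_zero (t : ℕ) (h1 : 1 ≤ t) : Int.fract ((t : ℝ) * omega) ≠ 0 := by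
  intro h
  rw [Int.fract_eq_zero_iff] at h
  obtain ⟨z, hz⟩ := h
  exact (irrational_omega.natCast_mul (by omega : t ≠ 0)).ne_int z hz.symm

lemma omega_mul_one_add : omega * (1 + omega) = 1 := by nlinarith [omega_sq]

lemma abs_S_omega_le (N : ℕ) : |S omega N| ≤ 3 * Real.sqrt N := by
  induction N using Nat.strong_induction_on with
  | _ N ih =>
    rcases Nat.eq_zero_or_pos N with rfl | hN
    · simp [S_zero]
    · refine abs_S_le_step (by linarith [omega_gt]) (by linarith [omega_lt]) omega_mul_one_add N
        (fun t h _ => fract_mul_omega_ne_zero t h) (ih _ ?_)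
      rw [Nat.floor_lt (mul_nonneg (Nat.cast_nonneg _) omega_pos.le)]
      have : (0 : ℝ) < N := by exact_mod_cast hN
      nlinarith [omega_lt_one]


/-! ### Uniform estimates for the factors of B and C -/

/-- The weight `π ω^{n+1} cot (π t / F_{n+1})`. -/
noncomputable def cotWeight (n t : ℕ) : ℝ :=
  Real.pi * omega ^ (n + 1) *
    (Real.cos (Real.pi * t / Nat.fib (n + 1)) / Real.sin (Real.pi * t / Nat.fib (n + 1)))

/-- The factors of `B (n + 1)`. -/
noncomputable def bFactor (n t : ℕ) : ℝ :=
  s (n + 1) t / (2 * Real.sin (Real.pi * t / Nat.fib (n + 1)))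

lemma theta_succ_eq (n t : ℕ) :
    theta (n + 1) t = (t : ℝ) / Nat.fib (n + 1) - omega ^ (n + 1) * u (conv n) t := by
  rw [theta, u, fract_mul_conv, Nat.add_sub_cancel]

section bounds

variable {n t : ℕ} (ht : 1 ≤ t) (htq : 2 * t ≤ Nat.fib (n + 1))

include ht in
lemma angle_pos : 0 < Real.pi * t / Nat.fib (n + 1) := by
  have := fib_succ_pos_real n
  have : (0 : ℝ) < t := by exact_mod_cast ht
  have := Real.pi_pos
  positivity

include htq in
lemma angle_le : Real.pi * t / Nat.fib (n + 1) ≤ Real.pi / 2 := by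
  have hq := fib_succ_pos_real n
  have h : (2 : ℝ) * t ≤ Nat.fib (n + 1) := by exact_mod_cast htq
  rw [div_le_div_iff₀ hq two_pos]
  nlinarith [Real.pi_pos]

include htq in
lemma le_sin_angle : 2 * (t : ℝ) / Nat.fib (n + 1) ≤ Real.sin (Real.pi * t / Nat.fib (n + 1)) := by
  have hq := fib_succ_pos_real n
  have h := Real.mul_le_sin (x := Real.pi * t / Nat.fib (n + 1))
    (by have := Real.pi_pos; positivity) (angle_le htq)
  refine le_trans (le_of_eq ?_) h
  have := Real.pi_ne_zero
  field_simp

include ht htq in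
lemma sin_angle_pos : 0 < Real.sin (Real.pi * t / Nat.fib (n + 1)) := by
  refine Real.sin_pos_of_pos_of_lt_pi (angle_pos ht) ((angle_le htq).trans_lt ?_)
  linarith [Real.pi_pos]

include ht htq in
lemma cot_angle_bounds :
    0 ≤ Real.cos (Real.pi * t / Nat.fib (n + 1)) / Real.sin (Real.pi * t / Nat.fib (n + 1)) ∧
    Real.cos (Real.pi * t / Nat.fib (n + 1)) / Real.sin (Real.pi * t / Nat.fib (n + 1)) ≤
      Nat.fib (n + 1) / (Real.pi * t) := by
  have hs := sin_angle_pos ht htq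
  have h0 := angle_pos (n := n) ht
  have h1 := angle_le htq
  have hq := fib_succ_pos_real n
  rw [show (Nat.fib (n + 1) : ℝ) / (Real.pi * t) = 1 / (Real.pi * t / Nat.fib (n + 1)) by
    rw [one_div_div]]
  set y := Real.pi * t / Nat.fib (n + 1)
  have hc : 0 ≤ Real.cos y := Real.cos_nonneg_of_neg_pi_div_two_le_of_le (by linarith) h1
  refine ⟨by positivity, ?_⟩
  rw [div_le_div_iff₀ hs h0, one_mul]
  rcases h1.lt_or_eq with h | h
  · have hcp : 0 < Real.cos y := Real.cos_pos_of_mem_Ioo ⟨by linarith, h⟩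
    have := Real.lt_tan h0 h
    rw [Real.tan_eq_sin_div_cos, lt_div_iff₀ hcp] at this
    linarith
  · rw [h, Real.cos_pi_div_two, zero_mul]
    exact h ▸ hs.le

include ht htq in
lemma cotWeight_bounds (ha : omega ^ (n + 1) * Nat.fib (n + 1) ≤ 1 / 2) :
    0 ≤ cotWeight n t ∧ cotWeight n t ≤ 1 / (2 * t) := by
  obtain ⟨h1, h2⟩ := cot_angle_bounds ht htq
  have hw : 0 < omega ^ (n + 1) := pow_pos omega_pos _
  have ht0 : (0 : ℝ) < t := by exact_mod_cast ht
  have hpi := Real.pi_pos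
  refine ⟨mul_nonneg (by positivity) h1, ?_⟩
  calc cotWeight n t ≤ Real.pi * omega ^ (n + 1) * (Nat.fib (n + 1) / (Real.pi * t)) := by
        unfold cotWeight; gcongr
    _ = omega ^ (n + 1) * Nat.fib (n + 1) / t := by field_simp
    _ ≤ (1 / 2) / t := by gcongr
    _ = 1 / (2 * t) := by ring

include ht in
-- From cot a - cot b = sin(b-a)/(sin a sin b) and Jordan's inequality. Against |S| ≤ 3√t this decay
-- gives the summable bound t^{-3/2} in the Abel summation.
lemma cotWeight_sub_bounds (ha : omega ^ (n + 1) * Nat.fib (n + 1) ≤ 1 / 2)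
    (htq : 2 * (t + 1) ≤ Nat.fib (n + 1)) :
    |cotWeight n t - cotWeight n (t + 1)| ≤ 2 / (t : ℝ) ^ 2 := by
  have hq := fib_succ_pos_real n
  have hs := sin_angle_pos ht (by omega : 2 * t ≤ Nat.fib (n + 1))
  have hs' := sin_angle_pos (by omega : 1 ≤ t + 1) htq
  have hl := le_sin_angle (by omega : 2 * t ≤ Nat.fib (n + 1))
  have hl' := le_sin_angle htq
  have hw : 0 < omega ^ (n + 1) := pow_pos omega_pos _
  have ht0 : (0 : ℝ) < t := by exact_mod_cast ht
  have hpi := Real.pi_pos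
  have key : cotWeight n t - cotWeight n (t + 1) =
      Real.pi * omega ^ (n + 1) * (Real.sin (Real.pi / Nat.fib (n + 1)) /
        (Real.sin (Real.pi * t / Nat.fib (n + 1)) *
          Real.sin (Real.pi * (t + 1 : ℕ) / Nat.fib (n + 1)))) := by
    have e : Real.pi / Nat.fib (n + 1) =
        Real.pi * (t + 1 : ℕ) / Nat.fib (n + 1) - Real.pi * t / Nat.fib (n + 1) := by
      push_cast; ring
    rw [e, Real.sin_sub, cotWeight, cotWeight]
    field_simp
  have hs1 : 0 ≤ Real.sin (Real.pi / Nat.fib (n + 1)) := by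
    apply Real.sin_nonneg_of_nonneg_of_le_pi (by positivity)
    apply div_le_self hpi.le
    exact_mod_cast Nat.fib_pos.2 (Nat.succ_pos n)
  rw [key, abs_of_nonneg (by positivity)]
  have hle : Real.sin (Real.pi / Nat.fib (n + 1)) ≤ Real.pi / Nat.fib (n + 1) :=
    Real.sin_le (by positivity)
  have hl2 : 2 * (t : ℝ) / Nat.fib (n + 1) ≤
      Real.sin (Real.pi * (t + 1 : ℕ) / Nat.fib (n + 1)) := by
    refine le_trans ?_ hl'
    gcongr
    simp
  calc Real.pi * omega ^ (n + 1) * (Real.sin (Real.pi / Nat.fib (n + 1)) /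
        (Real.sin (Real.pi * t / Nat.fib (n + 1)) *
          Real.sin (Real.pi * (t + 1 : ℕ) / Nat.fib (n + 1))))
      ≤ Real.pi * omega ^ (n + 1) * ((Real.pi / Nat.fib (n + 1)) /
        ((2 * (t : ℝ) / Nat.fib (n + 1)) * (2 * (t : ℝ) / Nat.fib (n + 1)))) := by gcongr
    _ = Real.pi ^ 2 / 4 * (omega ^ (n + 1) * Nat.fib (n + 1)) / (t : ℝ) ^ 2 := by
        field_simp; ring
    _ ≤ 2 / (t : ℝ) ^ 2 := by
        gcongr
        nlinarith [Real.pi_lt_d2, mul_pos hw hq]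

include ht htq in
lemma bFactor_eq : bFactor n t = Real.cos (Real.pi * omega ^ (n + 1) * u (conv n) t) -
    Real.cos (Real.pi * t / Nat.fib (n + 1)) / Real.sin (Real.pi * t / Nat.fib (n + 1)) *
      Real.sin (Real.pi * omega ^ (n + 1) * u (conv n) t) := by
  have hs := sin_angle_pos ht htq
  rw [bFactor, s_eq_theta, theta_succ_eq, show Real.pi * ((t : ℝ) / Nat.fib (n + 1) -
    omega ^ (n + 1) * u (conv n) t) = Real.pi * t / Nat.fib (n + 1) -
      Real.pi * omega ^ (n + 1) * u (conv n) t by ring, Real.sin_sub]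
  field_simp

include ht htq in
lemma bFactor_sub_bounds (hq10 : 10 ≤ Nat.fib (n + 1))
    (ha : omega ^ (n + 1) * Nat.fib (n + 1) ≤ 1 / 2) :
    |bFactor n t - 1 + u (conv n) t * cotWeight n t| ≤ 1 / (2 * (t : ℝ) ^ 2) ∧
    |bFactor n t - 1| ≤ 3 / (10 * t) := by
  have hq := fib_succ_pos_real n
  obtain ⟨hc0, hc1⟩ := cot_angle_bounds ht htq
  obtain ⟨hk0, hk1⟩ := cotWeight_bounds ht htq ha
  have hu := abs_u_le (conv n) t
  have hw : 0 < omega ^ (n + 1) := pow_pos omega_pos _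
  have ht1 : (1 : ℝ) ≤ t := by exact_mod_cast ht
  have ht0 : (0 : ℝ) < t := by linarith
  have hpi := Real.pi_pos
  have hpi3 := Real.pi_gt_three
  have hpi4 := Real.pi_lt_d2
  have h2t : 2 * (t : ℝ) ≤ Nat.fib (n + 1) := by exact_mod_cast htq
  have h10 : (10 : ℝ) ≤ Nat.fib (n + 1) := by exact_mod_cast hq10
  rw [bFactor_eq ht htq]
  have hkdef : cotWeight n t = Real.pi * omega ^ (n + 1) *
    (Real.cos (Real.pi * t / Nat.fib (n + 1)) / Real.sin (Real.pi * t / Nat.fib (n + 1))) := rfl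
  set q : ℝ := (Nat.fib (n + 1) : ℝ)
  set ct := Real.cos (Real.pi * t / q) / Real.sin (Real.pi * t / q)
  set v := u (conv n) t
  set h := Real.pi * omega ^ (n + 1) * v with hh
  have hw2 : omega ^ (n + 1) ≤ 1 / (2 * q) := by
    rw [le_div_iff₀ (by positivity)]; linarith
  -- The product of π, ω^{n+1} ≤ 1/(2q) and |u| ≤ 1/2 is at most π/(4q).
  have habs : |h| ≤ 4 / 5 / q := by
    rw [hh, abs_mul, abs_of_pos (by positivity : 0 < Real.pi * omega ^ (n + 1))]
    calc Real.pi * omega ^ (n + 1) * |v| ≤ 3.15 * (1 / (2 * q)) * (1 / 2) := by gcongr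
      _ ≤ 4 / 5 / q := by
        rw [show (3.15 : ℝ) * (1 / (2 * q)) * (1 / 2) = 3.15 / 4 / q by ring]
        exact div_le_div_of_nonneg_right (by norm_num) hq.le
  have hsq : h ^ 2 ≤ (4 / 5 / q) ^ 2 := by
    rw [← sq_abs h]; gcongr
  have hcos1 := Real.one_sub_sq_div_two_le_cos (x := h)
  have hcos2 := Real.cos_le_one h
  have hh1 : |h| ≤ 1 := habs.trans (by rw [div_le_one hq]; linarith)
  have hsin : |h - Real.sin h| ≤ (4 / 5 / q) ^ 2 / 6 := by
    refine (Real.abs_sub_sin_le h).trans ?_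
    gcongr
    calc |h| ^ 3 = h ^ 2 * |h| := by rw [← sq_abs]; ring
      _ ≤ h ^ 2 * 1 := by gcongr
      _ ≤ (4 / 5 / q) ^ 2 := by linarith
  have hcs : |ct * (h - Real.sin h)| ≤ q / (Real.pi * t) * ((4 / 5 / q) ^ 2 / 6) := by
    rw [abs_mul, abs_of_nonneg hc0]; gcongr
  have hcs2 : q / (Real.pi * t) * ((4 / 5 / q) ^ 2 / 6) ≤ 1 / 27 / (t * q) := by
    rw [show q / (Real.pi * t) * ((4 / 5 / q) ^ 2 / 6) = (16 / 150 / Real.pi) / (t * q) by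
      field_simp; norm_num]
    refine div_le_div_of_nonneg_right ?_ (by positivity)
    rw [div_le_iff₀ hpi]; nlinarith
  have hid : Real.cos h - ct * Real.sin h - 1 + v * cotWeight n t =
      (Real.cos h - 1) + ct * (h - Real.sin h) := by rw [hkdef, hh]; ring
  have hmain : |Real.cos h - ct * Real.sin h - 1 + v * cotWeight n t| ≤
      (4 / 5 / q) ^ 2 / 2 + 1 / 27 / (t * q) := by
    rw [hid]
    have h3 := abs_le.1 (hcs.trans hcs2)
    rw [abs_le]
    have h4 : 0 ≤ (4 / 5 / q) ^ 2 := sq_nonneg _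
    constructor <;> linarith
  have e1 : (4 / 5 / q) ^ 2 / 2 ≤ 8 / 25 / (q * (2 * t)) := by
    rw [show (4 / 5 / q) ^ 2 / 2 = 8 / 25 / (q * q) by ring]
    gcongr
  have e2 : (4 / 5 / q) ^ 2 / 2 + 1 / 27 / (t * q) ≤ 1 / 5 / (t * q) := by
    have : 8 / 25 / (q * (2 * t)) = 4 / 25 / (t * q) := by ring
    rw [this] at e1
    have e3 : (4 : ℝ) / 25 / (t * q) + 1 / 27 / (t * q) ≤ 1 / 5 / (t * q) := by
      rw [← add_div]; gcongr; norm_num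
    linarith
  constructor
  · refine (hmain.trans e2).trans ?_
    rw [div_le_div_iff₀ (by positivity) (by positivity)]
    linarith [mul_le_mul_of_nonneg_left h2t ht0.le, sq (t : ℝ), mul_self_nonneg (t : ℝ)]
  · have hvk : |v * cotWeight n t| ≤ 1 / (4 * t) := by
      rw [abs_mul, abs_of_nonneg hk0]
      calc |v| * cotWeight n t ≤ 1 / 2 * (1 / (2 * t)) := by gcongr
        _ = 1 / (4 * t) := by ring
    have e4 : 1 / 5 / (t * q) ≤ 1 / (20 * t) := by
      rw [div_le_div_iff₀ (by positivity) (by positivity)]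
      linarith [mul_le_mul_of_nonneg_left h10 ht0.le]
    have e5 : (1 : ℝ) / (4 * t) + 1 / (20 * t) = 3 / (10 * t) := by ring
    have h6 := abs_le.1 ((hmain.trans e2).trans e4)
    have h7 := abs_le.1 hvk
    rw [abs_le, ← e5]
    constructor <;> linarith

lemma abs_log_one_add_sub_le {z : ℝ} (hz : |z| ≤ 1 / 2) : |Real.log (1 + z) - z| ≤ 2 * z ^ 2 := by
  have hz' := abs_le.1 hz
  have h1 := Real.log_le_sub_one_of_pos (by linarith : 0 < 1 + z)
  have h2 := Real.one_sub_inv_le_log_of_pos (by linarith : 0 < 1 + z)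
  have h3 : z - 2 * z ^ 2 ≤ 1 - (1 + z)⁻¹ := by
    rw [show 1 - (1 + z)⁻¹ = z / (1 + z) by field_simp [(by linarith : (1 + z) ≠ 0)]; ring,
      le_div_iff₀ (by linarith)]
    nlinarith [sq_nonneg z]
  rw [abs_le]
  constructor <;> nlinarith [sq_nonneg z]

include ht htq in
lemma bFactor_ge (hq10 : 10 ≤ Nat.fib (n + 1))
    (ha : omega ^ (n + 1) * Nat.fib (n + 1) ≤ 1 / 2) : 7 / 10 ≤ bFactor n t := by
  have h := (bFactor_sub_bounds ht htq hq10 ha).2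
  have ht1 : (1 : ℝ) ≤ t := by exact_mod_cast ht
  have : 3 / (10 * (t : ℝ)) ≤ 3 / 10 := by
    rw [div_le_div_iff₀ (by positivity) (by norm_num)]; linarith
  linarith [(abs_le.1 h).1]

include ht htq in
lemma abs_log_bFactor_le (hq10 : 10 ≤ Nat.fib (n + 1))
    (ha : omega ^ (n + 1) * Nat.fib (n + 1) ≤ 1 / 2) :
    |Real.log (bFactor n t) + u (conv n) t * cotWeight n t| ≤ 1 / (t : ℝ) ^ 2 := by
  obtain ⟨h1, h2⟩ := bFactor_sub_bounds ht htq hq10 ha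
  have ht1 : (1 : ℝ) ≤ t := by exact_mod_cast ht
  have h3 : 3 / (10 * (t : ℝ)) ≤ 1 / 2 := by
    rw [div_le_div_iff₀ (by positivity) (by norm_num)]; linarith
  have h4 := abs_log_one_add_sub_le (h2.trans h3)
  rw [add_sub_cancel] at h4
  have h5 : (bFactor n t - 1) ^ 2 ≤ (3 / (10 * (t : ℝ))) ^ 2 := by
    rw [← sq_abs]; gcongr
  have h6 : 2 * (3 / (10 * (t : ℝ))) ^ 2 = 9 / 50 / (t : ℝ) ^ 2 := by ring
  have h7 : (9 : ℝ) / 50 / (t : ℝ) ^ 2 + 1 / (2 * (t : ℝ) ^ 2) ≤ 1 / (t : ℝ) ^ 2 := by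
    rw [show (1 : ℝ) / (2 * (t : ℝ) ^ 2) = 1 / 2 / (t : ℝ) ^ 2 by ring, ← add_div]
    gcongr; norm_num
  rw [abs_le] at *
  constructor <;> linarith

include ht htq in
lemma s_ratio_bound (hq10 : 10 ≤ Nat.fib (n + 1))
    (ha : omega ^ (n + 1) * Nat.fib (n + 1) ≤ 1 / 2) :
    s (n + 1) 0 ^ 2 / s (n + 1) t ^ 2 ≤ 1 / (3 * (t : ℝ) ^ 2) := by
  have hq := fib_succ_pos_real n
  have hb := bFactor_ge ht htq hq10 ha
  have hs := sin_angle_pos ht htq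
  have hl := le_sin_angle htq
  have ht1 : (1 : ℝ) ≤ t := by exact_mod_cast ht
  have hw : 0 < omega ^ (n + 1) := pow_pos omega_pos _
  have hpi := Real.pi_pos
  have h1 : s (n + 1) t = bFactor n t * (2 * Real.sin (Real.pi * t / Nat.fib (n + 1))) := by
    unfold bFactor; field_simp
  have h2 : 7 / 10 * (2 * (2 * (t : ℝ) / Nat.fib (n + 1))) ≤ s (n + 1) t := by
    rw [h1]; gcongr
  have h3 : 0 ≤ s (n + 1) 0 := by
    rw [s_eq_theta, theta_zero]
    have : omega ^ (n + 1) ≤ 1 := pow_le_one₀ omega_pos.le omega_lt_one.le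
    exact mul_nonneg two_pos.le (Real.sin_nonneg_of_nonneg_of_le_pi (by positivity)
      (by nlinarith))
  have h4 : s (n + 1) 0 ≤ 1.6 / Nat.fib (n + 1) := by
    rw [s_eq_theta, theta_zero]
    have := Real.sin_le (by positivity : 0 ≤ Real.pi * (omega ^ (n + 1) / 2))
    rw [le_div_iff₀ hq]
    nlinarith [Real.pi_lt_d2, mul_pos hw hq]
  -- Here 1.6 exceeds π/2, 2.8 is 4 · 7/10, and (1.6/2.8)² < 1/3.
  calc s (n + 1) 0 ^ 2 / s (n + 1) t ^ 2
      ≤ (1.6 / Nat.fib (n + 1)) ^ 2 / (7 / 10 * (2 * (2 * (t : ℝ) / Nat.fib (n + 1)))) ^ 2 := by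
        gcongr
    _ = (1.6 ^ 2 / 2.8 ^ 2) / (t : ℝ) ^ 2 := by field_simp; norm_num
    _ ≤ 1 / 3 / (t : ℝ) ^ 2 := div_le_div_of_nonneg_right (by norm_num) (by positivity)
    _ = 1 / (3 * (t : ℝ) ^ 2) := by ring

include ht htq in
lemma abs_log_one_sub_s_ratio_le (hq10 : 10 ≤ Nat.fib (n + 1))
    (ha : omega ^ (n + 1) * Nat.fib (n + 1) ≤ 1 / 2) :
    |Real.log (1 - s (n + 1) 0 ^ 2 / s (n + 1) t ^ 2)| ≤ 1 / (t : ℝ) ^ 2 := by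
  have h := s_ratio_bound ht htq hq10 ha
  have h0 : 0 ≤ s (n + 1) 0 ^ 2 / s (n + 1) t ^ 2 := by positivity
  have ht1 : (1 : ℝ) ≤ t := by exact_mod_cast ht
  set w := s (n + 1) 0 ^ 2 / s (n + 1) t ^ 2
  have h2 : (1 : ℝ) / (3 * (t : ℝ) ^ 2) ≤ 1 / 3 := by
    rw [div_le_div_iff₀ (by positivity) (by norm_num)]; nlinarith
  have h1 := Real.log_le_sub_one_of_pos (by linarith : 0 < 1 - w)
  have h3 := Real.one_sub_inv_le_log_of_pos (by linarith : 0 < 1 - w)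
  have h4 : -(3 / 2 * w) ≤ 1 - (1 - w)⁻¹ := by
    have hw : (1 - w) ≠ 0 := by linarith
    rw [show 1 - (1 - w)⁻¹ = -(w / (1 - w)) by field_simp; ring, neg_le_neg_iff,
      div_le_iff₀ (by linarith)]
    nlinarith
  have h5 : 3 / 2 * (1 / (3 * (t : ℝ) ^ 2)) ≤ 1 / (t : ℝ) ^ 2 := by
    rw [show 3 / 2 * (1 / (3 * (t : ℝ) ^ 2)) = 1 / 2 / (t : ℝ) ^ 2 by ring]
    gcongr; norm_num
  rw [abs_le]
  constructor <;> nlinarith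

end bounds


/-! ### Convergence of A, B and C -/

lemma tendsto_omega_pow : Tendsto (fun n : ℕ => omega ^ (n + 1)) atTop (𝓝 0) :=
  (tendsto_pow_atTop_nhds_zero_of_lt_one omega_pos.le omega_lt_one).comp (tendsto_add_atTop_nat 1)

lemma tendsto_omega_pow_mul_fib :
    Tendsto (fun n : ℕ => omega ^ (n + 1) * Nat.fib (n + 1)) atTop (𝓝 (1 / Real.sqrt 5)) := by
  have h5 : Real.sqrt 5 ≠ 0 := by positivity
  have key : ∀ n : ℕ, omega ^ (n + 1) * Nat.fib (n + 1) =
      (1 - (-omega ^ 2) ^ (n + 1)) / Real.sqrt 5 := by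
    intro n
    rw [Real.coe_fib_eq, omega_eq_neg_goldenConj, mul_div_assoc', mul_sub, ← mul_pow, ← mul_pow,
      show -Real.goldenConj * Real.goldenRatio = 1 by
        linarith [Real.goldenConj_mul_goldenRatio], one_pow]
    ring_nf
  have h0 : Tendsto (fun n : ℕ => (-omega ^ 2) ^ (n + 1)) atTop (𝓝 0) := by
    refine (tendsto_pow_atTop_nhds_zero_of_abs_lt_one ?_).comp (tendsto_add_atTop_nat 1)
    rw [abs_neg, abs_of_nonneg (sq_nonneg _)]
    nlinarith [omega_pos, omega_lt_one]
  simp_rw [key]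
  simpa using ((tendsto_const_nhds (x := (1 : ℝ))).sub h0).div_const (Real.sqrt 5)

lemma tendsto_fib_succ : Tendsto (fun n : ℕ => Nat.fib (n + 1)) atTop atTop := by
  refine tendsto_atTop_mono' atTop ?_ tendsto_id
  filter_upwards [eventually_ge_atTop 5] with n hn
  exact (Nat.le_fib_self hn).trans Nat.fib_le_fib_succ

lemma tendsto_half_fib : Tendsto (fun n : ℕ => Nat.fib (n + 1) / 2) atTop atTop :=
  (Nat.tendsto_div_const_atTop two_ne_zero).comp tendsto_fib_succ

/-- The limit 1/√5 of ωⁿF_n is below 1/2, so the uniform estimates apply for all large n. -/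
lemma eventually_large_fib : ∀ᶠ n : ℕ in atTop,
    10 ≤ Nat.fib (n + 1) ∧ omega ^ (n + 1) * Nat.fib (n + 1) ≤ 1 / 2 := by
  have h5 : 1 / Real.sqrt 5 < 1 / 2 := by
    apply one_div_lt_one_div_of_lt two_pos
    rw [sqrt_five_eq]; linarith [omega_gt]
  exact (tendsto_fib_succ.eventually_ge_atTop 10).and
    (tendsto_omega_pow_mul_fib.eventually_le_const h5)

lemma tendsto_conv : Tendsto conv atTop (𝓝 omega) := by
  rw [omega_eq_neg_goldenConj]
  exact tendsto_fib_div_fib_succ_atTop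

lemma tendsto_u_conv (t : ℕ) (ht : 1 ≤ t) :
    Tendsto (fun n => u (conv n) t) atTop (𝓝 (u omega t)) := by
  have h : ContinuousAt (Int.fract : ℝ → ℝ) ((t : ℝ) * omega) := by
    refine continuousAt_fract fun h => fract_mul_omega_ne_zero t ht ?_
    rw [Int.fract, ← h, sub_self]
  exact (h.tendsto.comp (tendsto_conv.const_mul _)).sub_const _

lemma tendsto_S_conv (N : ℕ) : Tendsto (fun n => S (conv n) N) atTop (𝓝 (S omega N)) :=
  tendsto_finsetSum _ fun t _ => tendsto_u_conv (t + 1) (by omega)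

lemma sin_eq_mul_sinc (x : ℝ) : Real.sin x = x * Real.sinc x := by
  rcases eq_or_ne x 0 with rfl | h
  · simp
  · rw [Real.sinc_of_ne_zero h]; field_simp

lemma tendsto_sinc {f : ℕ → ℝ} (hf : Tendsto f atTop (𝓝 0)) :
    Tendsto (fun n => Real.sinc (f n)) atTop (𝓝 1) := by
  have := (Real.continuous_sinc.tendsto 0).comp hf
  rwa [Real.sinc_zero] at this

lemma tendsto_cos_one {f : ℕ → ℝ} (hf : Tendsto f atTop (𝓝 0)) :
    Tendsto (fun n => Real.cos (f n)) atTop (𝓝 1) := by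
  have := (Real.continuous_cos.tendsto 0).comp hf
  rwa [Real.cos_zero] at this

theorem tendsto_A : Tendsto A atTop (𝓝 (2 * Real.pi / Real.sqrt 5)) := by
  rw [← tendsto_add_atTop_iff_nat 1]
  have h1 : Tendsto (fun n : ℕ => Real.pi * omega ^ (n + 1)) atTop (𝓝 0) := by
    simpa using tendsto_omega_pow.const_mul Real.pi
  have h2 := ((tendsto_omega_pow_mul_fib.const_mul (2 * Real.pi)).mul (tendsto_sinc h1))
  rw [mul_one, mul_one_div] at h2
  refine h2.congr fun n => ?_
  rw [A, sin_eq_mul_sinc]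
  ring

lemma tendsto_angle (t : ℕ) :
    Tendsto (fun n : ℕ => Real.pi * t / Nat.fib (n + 1)) atTop (𝓝 0) :=
  (tendsto_natCast_atTop_atTop.comp tendsto_fib_succ).const_div_atTop _

lemma tendsto_cotWeight (t : ℕ) (ht : 1 ≤ t) :
    Tendsto (fun n => cotWeight n t) atTop (𝓝 (1 / Real.sqrt 5 / t)) := by
  have ht0 : (t : ℝ) ≠ 0 := by positivity
  have h := (tendsto_omega_pow_mul_fib.div_const (t : ℝ)).mul
    ((tendsto_cos_one (tendsto_angle t)).div (tendsto_sinc (tendsto_angle t)) one_ne_zero)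
  rw [div_one, mul_one] at h
  refine h.congr fun n => ?_
  have hq := (fib_succ_pos_real n).ne'
  have := Real.pi_ne_zero
  simp only [Pi.div_apply]
  rw [cotWeight, sin_eq_mul_sinc (Real.pi * t / Nat.fib (n + 1))]
  rcases eq_or_ne (Real.sinc (Real.pi * t / Nat.fib (n + 1))) 0 with h0 | h0
  · simp [h0]
  · field_simp

/-- The limit of the factors of `B n`. -/
noncomputable def bLim (t : ℕ) : ℝ := 1 - u omega t * (1 / Real.sqrt 5 / t)

/-- The limit of the ratios `s n 0 / s n t`. -/
noncomputable def ratioLim (t : ℕ) : ℝ := 1 / Real.sqrt 5 / (2 * t * bLim t)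

lemma inv_sqrt_five_bounds : 0 < 1 / Real.sqrt 5 ∧ 1 / Real.sqrt 5 < 1 / 2 := by
  constructor
  · positivity
  · apply one_div_lt_one_div_of_lt two_pos
    rw [sqrt_five_eq]; linarith [omega_gt]

lemma bLim_ge (t : ℕ) (ht : 1 ≤ t) : 3 / 4 ≤ bLim t := by
  have hu := abs_le.1 (abs_u_le omega t)
  obtain ⟨h0, h1⟩ := inv_sqrt_five_bounds
  have ht1 : (1 : ℝ) ≤ t := by exact_mod_cast ht
  have h2 : 1 / Real.sqrt 5 / t ≤ 1 / 2 := (div_le_self h0.le ht1).trans h1.le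
  have h3 : 0 ≤ 1 / Real.sqrt 5 / t := by positivity
  unfold bLim
  nlinarith

lemma ratioLim_sq_lt (t : ℕ) (ht : 1 ≤ t) : ratioLim t ^ 2 < 1 := by
  have hb := bLim_ge t ht
  obtain ⟨h0, h1⟩ := inv_sqrt_five_bounds
  have ht1 : (1 : ℝ) ≤ t := by exact_mod_cast ht
  have h2 : 0 ≤ ratioLim t := by unfold ratioLim; positivity
  have h3 : ratioLim t < 1 := by
    unfold ratioLim
    rw [div_lt_one (by positivity)]
    nlinarith
  nlinarith

lemma tendsto_bFactor (t : ℕ) (ht : 1 ≤ t) :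
    Tendsto (fun n => bFactor n t) atTop (𝓝 (bLim t)) := by
  have hh : Tendsto (fun n => Real.pi * omega ^ (n + 1) * u (conv n) t) atTop (𝓝 0) := by
    simpa using (tendsto_omega_pow.const_mul Real.pi).mul (tendsto_u_conv t ht)
  have h := (tendsto_cos_one hh).sub
    (((tendsto_u_conv t ht).mul (tendsto_cotWeight t ht)).mul (tendsto_sinc hh))
  rw [mul_one] at h
  refine h.congr' ?_
  filter_upwards [tendsto_fib_succ.eventually_ge_atTop (2 * t)] with n hn
  rw [bFactor_eq ht hn, sin_eq_mul_sinc (Real.pi * omega ^ (n + 1) * u (conv n) t), cotWeight]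
  ring

lemma tendsto_s_ratio (t : ℕ) (ht : 1 ≤ t) :
    Tendsto (fun n => s (n + 1) 0 ^ 2 / s (n + 1) t ^ 2) atTop (𝓝 (ratioLim t ^ 2)) := by
  have ht0 : (t : ℝ) ≠ 0 := by positivity
  have hb := bLim_ge t ht
  have h1 : Tendsto (fun n : ℕ => Real.pi * (omega ^ (n + 1) / 2)) atTop (𝓝 0) := by
    simpa using (tendsto_omega_pow.div_const 2).const_mul Real.pi
  have h := (tendsto_omega_pow_mul_fib.mul (tendsto_sinc h1)).div
    (((tendsto_bFactor t ht).const_mul (2 * (t : ℝ))).mul (tendsto_sinc (tendsto_angle t)))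
    (by positivity)
  rw [mul_one, mul_one] at h
  refine (h.pow 2).congr' ?_
  filter_upwards [tendsto_fib_succ.eventually_ge_atTop (2 * t)] with n hn
  have hq := (fib_succ_pos_real n).ne'
  have hs := (sin_angle_pos ht hn).ne'
  have hpi := Real.pi_ne_zero
  simp only [Pi.div_apply]
  rw [← div_pow]
  congr 1
  have e1 : s (n + 1) t = bFactor n t * (2 * Real.sin (Real.pi * t / Nat.fib (n + 1))) := by
    unfold bFactor; field_simp
  rw [e1, s_eq_theta, theta_zero, sin_eq_mul_sinc (Real.pi * t / Nat.fib (n + 1)),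
    sin_eq_mul_sinc (Real.pi * (omega ^ (n + 1) / 2))]
  rcases eq_or_ne (bFactor n t) 0 with h0 | h0
  · simp [h0]
  rcases eq_or_ne (Real.sinc (Real.pi * t / Nat.fib (n + 1))) 0 with h2 | h2
  · simp [h2]
  field_simp

/-- Tannery's theorem for sums of growing length. -/
lemma tendsto_sum_range_of_dominated {T : ℕ → ℕ} (hT : Tendsto T atTop atTop) {f : ℕ → ℕ → ℝ}
    {F bd : ℕ → ℝ} (hbd : Summable bd) (hf : ∀ t, Tendsto (fun n => f n t) atTop (𝓝 (F t)))
    (hb : ∀ᶠ n in atTop, ∀ t < T n, |f n t| ≤ bd t) :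
    Summable F ∧ Tendsto (fun n => ∑ t ∈ Finset.range (T n), f n t) atTop (𝓝 (∑' t, F t)) := by
  have hle : ∀ t, ∀ᶠ n in atTop, |f n t| ≤ bd t := fun t => by
    filter_upwards [hb, hT.eventually_gt_atTop t] with n h1 h2 using h1 t h2
  have hF : ∀ t, |F t| ≤ bd t := fun t => le_of_tendsto (hf t).abs (hle t)
  refine ⟨Summable.of_norm_bounded hbd hF, ?_⟩
  have h := tendsto_tsum_of_dominated_convergence (𝓕 := atTop)
    (f := fun n t => if t < T n then f n t else 0) (g := F) hbd
    (fun t => (hf t).congr' ?_) ?_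
  · refine h.congr fun n => ?_
    rw [tsum_eq_sum (s := Finset.range (T n)) fun t ht => if_neg (by simpa using ht)]
    exact Finset.sum_congr rfl fun t ht => if_pos (Finset.mem_range.1 ht)
  · filter_upwards [hT.eventually_gt_atTop t] with n hn
    rw [if_pos hn]
  · filter_upwards [hb] with n hn t
    split_ifs with h
    · exact hn t h
    · rw [norm_zero]; exact (abs_nonneg _).trans (hF t)

lemma sum_u_mul (α : ℝ) (k : ℕ → ℝ) (T : ℕ) :
    ∑ t ∈ Finset.range (T + 1), u α (t + 1) * k (t + 1) =
      S α (T + 1) * k (T + 1) +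
        ∑ t ∈ Finset.range T, S α (t + 1) * (k (t + 1) - k (t + 1 + 1)) := by
  induction T with
  | zero => simp [S]
  | succ T ih => rw [Finset.sum_range_succ, ih, Finset.sum_range_succ, S_succ α (T + 1)]; ring

lemma summable_sq_inv : Summable fun t : ℕ => 1 / ((t + 1 : ℕ) : ℝ) ^ 2 :=
  (summable_nat_add_iff 1).2 (Real.summable_one_div_nat_pow.2 one_lt_two)

lemma summable_sqrt_div_sq : Summable fun t : ℕ =>
    3 * Real.sqrt ((t + 1 : ℕ) : ℝ) * (2 / ((t + 1 : ℕ) : ℝ) ^ 2) := by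
  have h := ((summable_nat_add_iff 1).2
    (Real.summable_nat_rpow_inv.2 (by norm_num : (1 : ℝ) < 3 / 2))).mul_left 6
  refine h.congr fun t => ?_
  have ht : (0 : ℝ) < ((t + 1 : ℕ) : ℝ) := by positivity
  have e : ((t + 1 : ℕ) : ℝ) ^ 2 = ((t + 1 : ℕ) : ℝ) ^ (3 / 2 : ℝ) * Real.sqrt ((t + 1 : ℕ) : ℝ) := by
    rw [Real.sqrt_eq_rpow, ← Real.rpow_add ht, ← Real.rpow_natCast]; norm_num
  rw [e]
  have := Real.sqrt_pos.2 ht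
  have := Real.rpow_pos_of_pos ht (3 / 2 : ℝ)
  field_simp
  norm_num

lemma tendsto_inv_sqrt {T : ℕ → ℕ} (hT : Tendsto T atTop atTop) :
    Tendsto (fun n => 3 / Real.sqrt (T n)) atTop (𝓝 0) :=
  (Real.tendsto_sqrt_atTop.comp (tendsto_natCast_atTop_atTop.comp hT)).const_div_atTop _

/-- The limit of the linear parts `∑ u_t k_t`. -/
noncomputable def linLim : ℝ := ∑' t : ℕ, S omega (t + 1) *
  (1 / Real.sqrt 5 / ((t + 1 : ℕ) : ℝ) - 1 / Real.sqrt 5 / ((t + 1 + 1 : ℕ) : ℝ))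

/-- The weights decay only like 1/t, so domination is applied after summation by parts; the boundary
term S·k is O(N^{-1/2}). -/
lemma tendsto_linear_part : Tendsto (fun n => ∑ t ∈ Finset.range (Nat.fib (n + 1) / 2),
    u (conv n) (t + 1) * cotWeight n (t + 1)) atTop (𝓝 linLim) := by
  have hT : Tendsto (fun n : ℕ => Nat.fib (n + 1) / 2 - 1) atTop atTop :=
    (tendsto_sub_atTop_nat 1).comp tendsto_half_fib
  have h1 := (tendsto_sum_range_of_dominated hT
    (f := fun n t => S (conv n) (t + 1) * (cotWeight n (t + 1) - cotWeight n (t + 1 + 1)))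
    summable_sqrt_div_sq
    (fun t => (tendsto_S_conv (t + 1)).mul ((tendsto_cotWeight (t + 1) (by omega)).sub
      (tendsto_cotWeight (t + 1 + 1) (by omega)))) (by
      filter_upwards [eventually_large_fib] with n hn t ht
      rw [abs_mul]
      exact mul_le_mul (abs_S_conv_le n (t + 1) (by omega))
        (cotWeight_sub_bounds (by omega) hn.2 (by omega)) (abs_nonneg _) (by positivity))).2
  have h2 : Tendsto (fun n : ℕ => S (conv n) (Nat.fib (n + 1) / 2 - 1 + 1) *
      cotWeight n (Nat.fib (n + 1) / 2 - 1 + 1)) atTop (𝓝 0) := by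
    refine squeeze_zero_norm' ?_ (tendsto_inv_sqrt ((tendsto_add_atTop_nat 1).comp hT))
    filter_upwards [eventually_large_fib] with n hn
    have hT1 : 1 ≤ Nat.fib (n + 1) / 2 - 1 + 1 := by omega
    have hS := abs_S_conv_le n (Nat.fib (n + 1) / 2 - 1 + 1) (by omega)
    obtain ⟨hk0, hk1⟩ := cotWeight_bounds hT1 (by omega) hn.2
    simp only [Function.comp_apply]
    generalize Nat.fib (n + 1) / 2 - 1 + 1 = M at *
    have hM : (1 : ℝ) ≤ M := by exact_mod_cast hT1
    have hsq : Real.sqrt M * Real.sqrt M = M := Real.mul_self_sqrt (by positivity)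
    have hsp : 0 < Real.sqrt M := Real.sqrt_pos.2 (by linarith)
    rw [Real.norm_eq_abs, abs_mul, abs_of_nonneg hk0]
    calc |S (conv n) M| * cotWeight n M ≤ 3 * Real.sqrt M * (1 / (2 * M)) := by gcongr
      _ = 3 / 2 / Real.sqrt M := by nth_rw 2 [← hsq]; field_simp
      _ ≤ 3 / Real.sqrt M := by gcongr; norm_num
  have h3 := h2.add h1
  rw [zero_add] at h3
  refine h3.congr' ?_
  filter_upwards [eventually_large_fib] with n hn
  rw [← sum_u_mul (conv n) (cotWeight n), show Nat.fib (n + 1) / 2 - 1 + 1 = Nat.fib (n + 1) / 2 by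
    omega]

/-- The limit is the same `linLim` as for the convergents. Hence lim B·C can be evaluated as an
infinite product involving ω alone. -/
lemma tendsto_linear_part_omega : Tendsto (fun N => ∑ t ∈ Finset.range N,
    u omega (t + 1) * (1 / Real.sqrt 5 / ((t + 1 : ℕ) : ℝ))) atTop (𝓝 linLim) := by
  obtain ⟨hk0, hk1⟩ := inv_sqrt_five_bounds
  rw [← tendsto_add_atTop_iff_nat 1]
  have h1 := (tendsto_sum_range_of_dominated tendsto_id
    (f := fun _ t => S omega (t + 1) *
      (1 / Real.sqrt 5 / ((t + 1 : ℕ) : ℝ) - 1 / Real.sqrt 5 / ((t + 1 + 1 : ℕ) : ℝ)))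
    summable_sqrt_div_sq (fun t => tendsto_const_nhds) (by
      refine Eventually.of_forall fun n t _ => ?_
      rw [abs_mul]
      refine mul_le_mul (abs_S_omega_le _) ?_ (abs_nonneg _) (by positivity)
      have ht : (0 : ℝ) < ((t + 1 : ℕ) : ℝ) := by positivity
      have e : 1 / Real.sqrt 5 / ((t + 1 : ℕ) : ℝ) - 1 / Real.sqrt 5 / ((t + 1 + 1 : ℕ) : ℝ) =
          1 / Real.sqrt 5 / (((t + 1 : ℕ) : ℝ) * (((t + 1 : ℕ) : ℝ) + 1)) := by
        push_cast; field_simp; ring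
      rw [e, abs_of_pos (by positivity)]
      exact div_le_div₀ (by positivity) (by linarith) (by positivity) (by nlinarith))).2
  have h2 : Tendsto (fun N : ℕ => S omega (N + 1) * (1 / Real.sqrt 5 / ((N + 1 : ℕ) : ℝ)))
      atTop (𝓝 0) := by
    refine squeeze_zero_norm ?_ (tendsto_inv_sqrt (tendsto_add_atTop_nat 1))
    intro N
    have hS := abs_S_omega_le (N + 1)
    generalize N + 1 = M at *
    rcases Nat.eq_zero_or_pos M with rfl | hM0
    · simp
    have hM : (1 : ℝ) ≤ M := by exact_mod_cast hM0
    have hsq : Real.sqrt M * Real.sqrt M = M := Real.mul_self_sqrt (by positivity)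
    have hsp : 0 < Real.sqrt M := Real.sqrt_pos.2 (by linarith)
    rw [Real.norm_eq_abs, abs_mul, abs_of_nonneg (by positivity : 0 ≤ 1 / Real.sqrt 5 / (M : ℝ))]
    calc |S omega M| * (1 / Real.sqrt 5 / M) ≤ 3 * Real.sqrt M * (1 / M) := by
          gcongr; linarith
      _ = 3 / Real.sqrt M := by nth_rw 2 [← hsq]; field_simp
  have h3 := h2.add h1
  rw [zero_add] at h3
  exact h3.congr fun N =>
    (sum_u_mul omega (fun t => 1 / Real.sqrt 5 / (t : ℝ)) N).symm

/-- The limit of the remainders of `∑ log b_t`. -/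
noncomputable def remLim : ℝ := ∑' t : ℕ, (Real.log (bLim (t + 1)) +
  u omega (t + 1) * (1 / Real.sqrt 5 / ((t + 1 : ℕ) : ℝ)))

lemma tendsto_remainder_part : (Summable fun t : ℕ => (Real.log (bLim (t + 1)) +
    u omega (t + 1) * (1 / Real.sqrt 5 / ((t + 1 : ℕ) : ℝ)))) ∧
    Tendsto (fun n => ∑ t ∈ Finset.range (Nat.fib (n + 1) / 2),
      (Real.log (bFactor n (t + 1)) + u (conv n) (t + 1) * cotWeight n (t + 1))) atTop
      (𝓝 remLim) := by
  refine tendsto_sum_range_of_dominated tendsto_half_fib summable_sq_inv (fun t => ?_) ?_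
  · exact ((tendsto_bFactor (t + 1) (by omega)).log
      (by linarith [bLim_ge (t + 1) (by omega)] : (0 : ℝ) < bLim (t + 1)).ne').add
      ((tendsto_u_conv (t + 1) (by omega)).mul (tendsto_cotWeight (t + 1) (by omega)))
  · filter_upwards [eventually_large_fib] with n hn t ht
    exact abs_log_bFactor_le (by omega) (by omega) hn.1 hn.2

lemma tendsto_sum_log_bFactor : Tendsto (fun n => ∑ t ∈ Finset.range (Nat.fib (n + 1) / 2),
    Real.log (bFactor n (t + 1))) atTop (𝓝 (remLim - linLim)) := by
  refine (tendsto_remainder_part.2.sub tendsto_linear_part).congr fun n => ?_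
  rw [← Finset.sum_sub_distrib]
  exact Finset.sum_congr rfl fun t _ => by ring

lemma tendsto_sum_log_bLim : Tendsto (fun N => ∑ t ∈ Finset.range N,
    Real.log (bLim (t + 1))) atTop (𝓝 (remLim - linLim)) := by
  refine (tendsto_remainder_part.1.hasSum.tendsto_sum_nat.sub tendsto_linear_part_omega).congr
    fun n => ?_
  rw [← Finset.sum_sub_distrib]
  exact Finset.sum_congr rfl fun t _ => by ring

/-- The limit of `log (C n)`. -/
noncomputable def logCLim : ℝ := ∑' t : ℕ, Real.log (1 - ratioLim (t + 1) ^ 2)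

lemma tendsto_log_C_sum : (Summable fun t : ℕ => Real.log (1 - ratioLim (t + 1) ^ 2)) ∧
    Tendsto (fun n => ∑ t ∈ Finset.range (Nat.fib (n + 1) / 2),
      (if 2 * (t + 1) = Nat.fib (n + 1) then (1 / 2 : ℝ) else 1) *
        Real.log (1 - s (n + 1) 0 ^ 2 / s (n + 1) (t + 1) ^ 2)) atTop (𝓝 logCLim) := by
  refine tendsto_sum_range_of_dominated tendsto_half_fib summable_sq_inv (fun t => ?_) ?_
  · have h := ((tendsto_s_ratio (t + 1) (by omega)).const_sub 1).log
      (by linarith [ratioLim_sq_lt (t + 1) (by omega)] : (0 : ℝ) < 1 - ratioLim (t + 1) ^ 2).ne'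
    refine h.congr' ?_
    -- For fixed t the midpoint exponent 1/2 eventually disappears.
    filter_upwards [tendsto_fib_succ.eventually_gt_atTop (2 * (t + 1))] with n hn
    rw [if_neg (by omega), one_mul]
  · filter_upwards [eventually_large_fib] with n hn t ht
    have h := abs_log_one_sub_s_ratio_le (n := n) (t := t + 1) (by omega) (by omega) hn.1 hn.2
    rw [abs_mul]
    refine (mul_le_of_le_one_left (abs_nonneg _) ?_).trans h
    split_ifs <;> norm_num

lemma prod_Icc_one_eq_range (f : ℕ → ℝ) (T : ℕ) :
    ∏ t ∈ Finset.Icc 1 T, f t = ∏ t ∈ Finset.range T, f (t + 1) := by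
  rw [show Finset.Icc 1 T = Finset.Ico 1 (T + 1) from rfl, Finset.prod_Ico_eq_prod_range,
    Nat.add_sub_cancel]
  exact Finset.prod_congr rfl fun t _ => by rw [add_comm]

theorem tendsto_C : Tendsto C atTop (𝓝 (Real.exp logCLim)) := by
  rw [← tendsto_add_atTop_iff_nat 1]
  refine ((Real.continuous_exp.tendsto _).comp tendsto_log_C_sum.2).congr fun n => ?_
  rw [Function.comp_apply, Real.exp_sum, C, prod_Icc_one_eq_range]
  refine Finset.prod_congr rfl fun t ht => ?_
  rw [Finset.mem_range] at ht
  have h := one_sub_s_ratio_pos n (t + 1) (by omega) (by omega)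
  rw [Real.rpow_def_of_pos h, mul_comm]

lemma bFactor_pos {n t : ℕ} (ht : 1 ≤ t) (htq : t < Nat.fib (n + 1)) : 0 < bFactor n t := by
  have hq := fib_succ_pos_real n
  have h1 : (t : ℝ) < Nat.fib (n + 1) := by exact_mod_cast htq
  refine div_pos (s_pos n t ht htq) (mul_pos two_pos (Real.sin_pos_of_pos_of_lt_pi
    (angle_pos ht) ?_))
  rw [div_lt_iff₀ hq]
  exact mul_lt_mul_of_pos_left h1 Real.pi_pos

lemma bFactor_reflect {n t : ℕ} (ht : 1 ≤ t) (htq : t < Nat.fib (n + 1)) :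
    bFactor n (Nat.fib (n + 1) - t) = bFactor n t := by
  have hq := (fib_succ_pos_real n).ne'
  rw [bFactor, bFactor, s_reflect n t ht htq, Nat.cast_sub htq.le,
    show Real.pi * ((Nat.fib (n + 1) : ℝ) - t) / Nat.fib (n + 1) =
      Real.pi - Real.pi * t / Nat.fib (n + 1) by field_simp, Real.sin_pi_sub]

/-- The midpoint is fixed by the reflection, so its angle is exactly 1/2; the exponent attached to
it in the squared half-product is therefore irrelevant for B. -/
lemma bFactor_mid {n t : ℕ} (ht : 1 ≤ t) (htq : 2 * t = Nat.fib (n + 1)) : bFactor n t = 1 := by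
  have hθ := theta_reflect n t ht (by omega)
  rw [show Nat.fib (n + 1) - t = t by omega] at hθ
  have h2 : (Nat.fib (n + 1) : ℝ) = 2 * t := by exact_mod_cast htq.symm
  have ht0 : (t : ℝ) ≠ 0 := by positivity
  rw [bFactor, s_eq_theta, show theta (n + 1) t = 1 / 2 by linarith, h2,
    show Real.pi * t / (2 * t) = Real.pi * (1 / 2) by field_simp, mul_one_div, Real.sin_pi_div_two]
  norm_num

theorem tendsto_B : Tendsto B atTop (𝓝 (Real.exp (2 * (remLim - linLim)))) := by
  rw [← tendsto_add_atTop_iff_nat 1]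
  refine ((Real.continuous_exp.tendsto _).comp (tendsto_sum_log_bFactor.const_mul 2)).congr
    fun n => ?_
  have hB : B (n + 1) = ∏ t ∈ Finset.Ico 1 (Nat.fib (n + 1)), bFactor n t := rfl
  rw [hB, prod_Ico_eq_sq_of_reflect _ _ (fun t h1 h2 => bFactor_pos h1 h2)
    (fun t h1 h2 => bFactor_reflect h1 h2), prod_Icc_one_eq_range, Function.comp_apply,
    mul_comm, Real.exp_mul, Real.rpow_two, Real.exp_sum]
  congr 1
  refine Finset.prod_congr rfl fun t ht => ?_
  rw [Finset.mem_range] at ht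
  rw [Real.exp_log (bFactor_pos (by omega) (by omega))]
  split_ifs with h
  · rw [bFactor_mid (by omega) h, Real.one_rpow]
  · rw [Real.rpow_one]

/-- `∏_{n ≤ N} (β_n² (1 - w_n²))`, whose limit times `2π/√5` is the Sudler constant. -/
noncomputable def G (N : ℕ) : ℝ :=
  ∏ t ∈ Finset.range N, (bLim (t + 1) ^ 2 * (1 - ratioLim (t + 1) ^ 2))

lemma tendsto_G : Tendsto G atTop (𝓝 (Real.exp (2 * (remLim - linLim)) * Real.exp logCLim)) := by
  rw [← Real.exp_add]
  refine ((Real.continuous_exp.tendsto _).comp ((tendsto_sum_log_bLim.const_mul 2).add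
    tendsto_log_C_sum.1.hasSum.tendsto_sum_nat)).congr fun N => ?_
  rw [Function.comp_apply, Finset.mul_sum, ← Finset.sum_add_distrib, Real.exp_sum, G]
  refine Finset.prod_congr rfl fun t _ => ?_
  have hb := bLim_ge (t + 1) (by omega)
  have hr := ratioLim_sq_lt (t + 1) (by omega)
  rw [Real.exp_add, Real.exp_log (by linarith), mul_comm 2, Real.exp_mul, Real.exp_log (by linarith),
    Real.rpow_two]


/-! ### Tail of ∑ u_t/t by weighted renormalisation -/

lemma bLim_sq_mul (t : ℕ) (ht : 1 ≤ t) : bLim t ^ 2 * (1 - ratioLim t ^ 2) =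
    (1 - Int.fract (t * omega) * (1 / Real.sqrt 5 / t)) *
      (1 + (1 - Int.fract (t * omega)) * (1 / Real.sqrt 5 / t)) := by
  have hb := bLim_ge t ht
  have hb0 : bLim t ≠ 0 := by linarith
  have e : bLim t ^ 2 * (1 - ratioLim t ^ 2) = bLim t ^ 2 - (1 / Real.sqrt 5 / t) ^ 2 / 4 := by
    unfold ratioLim
    field_simp
    ring
  rw [e, bLim, u]
  ring

/-- The partial sums of `∑ u_t / t`. -/
noncomputable def T (N : ℕ) : ℝ := ∑ t ∈ Finset.range N, u omega (t + 1) / ((t + 1 : ℕ) : ℝ)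

lemma T_succ (N : ℕ) : T (N + 1) = T N + u omega (N + 1) / ((N + 1 : ℕ) : ℝ) :=
  Finset.sum_range_succ _ _

lemma exists_tendsto_T : ∃ τ : ℝ, Tendsto T atTop (𝓝 τ) := by
  have h5 : Real.sqrt 5 ≠ 0 := by positivity
  refine ⟨Real.sqrt 5 * linLim, (tendsto_linear_part_omega.const_mul (Real.sqrt 5)).congr
    fun N => ?_⟩
  rw [T, Finset.mul_sum]
  refine Finset.sum_congr rfl fun t _ => ?_
  field_simp

/-- The floor `⌊N ω⌋`. -/
noncomputable def fl (N : ℕ) : ℕ := ⌊(N : ℝ) * omega⌋₊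

/-- The coboundary `g` evaluated along the orbit of `ω`. -/
noncomputable def gOrb (N : ℕ) : ℝ := g omega (Int.fract ((N : ℝ) * omega))

lemma fract_mul_omega (N : ℕ) : Int.fract ((N : ℝ) * omega) = N * omega - fl N :=
  fract_eq_sub_natFloor (mul_nonneg (Nat.cast_nonneg _) omega_pos.le)

lemma gOrb_le (N : ℕ) : gOrb N ≤ 1 / 2 :=
  g_le_half omega_pos.le (Int.fract_nonneg _) (Int.fract_lt_one _).le

lemma gOrb_ge (N : ℕ) : -(omega / 8) ≤ gOrb N := g_ge omega_pos.le

/-- One step of the weighted renormalisation of `T`. -/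
lemma T_step (N : ℕ) (hN : 2 ≤ N) : 1 ≤ fl N ∧ ∃ e : ℝ,
    (T (N + 1) + omega * T (fl (N + 1))) - (T N + omega * T (fl N)) =
      (gOrb (N + 1) - gOrb N) / ((N + 1 : ℕ) : ℝ) + e ∧
    e ≤ omega ^ 2 / 16 * (1 / fl N - 1 / fl (N + 1)) ∧
    -(omega ^ 2 / 2 * (1 / fl N - 1 / fl (N + 1))) ≤ e := by
  have hw := omega_pos
  have hw2 := omega_sq
  have hM1 : 1 ≤ fl N := by
    refine Nat.le_floor ?_
    have : (2 : ℝ) ≤ N := by exact_mod_cast hN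
    push_cast
    nlinarith [omega_gt]
  refine ⟨hM1, ?_⟩
  have hN1 : (0 : ℝ) < ((N + 1 : ℕ) : ℝ) := by positivity
  rcases g_step hw omega_lt_one omega_mul_one_add N
    (fract_mul_omega_ne_zero (N + 1) (by omega)) with ⟨hM, hg⟩ | ⟨hM, hg⟩
  · change fl (N + 1) = fl N at hM
    change gOrb (N + 1) - gOrb N = _ at hg
    refine ⟨0, ?_, ?_, ?_⟩
    · rw [hM, T_succ, hg]; ring
    · rw [hM]; simp
    · rw [hM]; simp
  · change fl (N + 1) = fl N + 1 at hM
    change gOrb (N + 1) - gOrb N = u omega (N + 1) + u omega (fl N + 1) at hg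
    have hfr := fract_mul_omega (N + 1)
    have hfr0 := fract_mul_omega N
    have hy0 := Int.fract_nonneg (((N + 1 : ℕ) : ℝ) * omega)
    have hx1 := Int.fract_lt_one ((N : ℝ) * omega)
    rw [hM] at hfr
    set y := Int.fract (((N + 1 : ℕ) : ℝ) * omega) with hy
    have hyw : y < omega := by push_cast at hfr; linarith
    have hm : (1 : ℝ) ≤ fl N := by exact_mod_cast hM1
    have hu : u omega (fl N + 1) = 1 / 2 - y / omega := by
      have hyd : y / omega < 1 := (div_lt_one hw).2 hyw
      have hy1 : 0 < y := lt_of_le_of_ne hy0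
        (fract_mul_omega_ne_zero (N + 1) (by omega)).symm
      have hyd0 : 0 < y / omega := by positivity
      have hf : Int.fract (((fl N + 1 : ℕ) : ℝ) * omega) = 1 - y / omega := by
        rw [Int.fract_eq_iff]
        refine ⟨by linarith, by linarith, (N : ℤ) - fl N - 1, ?_⟩
        have hyo : y / omega = ((N + 1 : ℕ) : ℝ) - ((fl N + 1 : ℕ) : ℝ) * (1 + omega) := by
          rw [div_eq_iff hw.ne', hfr]
          linear_combination ((fl N + 1 : ℕ) : ℝ) * omega_mul_one_add
        rw [hyo]
        push_cast
        ring
      rw [u, hf]; ring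
    set θ := y / omega with hθ
    have hθ0 : 0 ≤ θ := by positivity
    have hθ1 : θ < 1 := (div_lt_one hw).2 hyw
    have hyθ : y = omega * θ := by rw [hθ]; field_simp
    set m : ℝ := ((fl N + 1 : ℕ) : ℝ) with hmd
    have hm2 : m = fl N + 1 := by rw [hmd]; push_cast; ring
    have hm0 : 0 < m := by linarith
    have hmy : 0 < m + omega * θ := by positivity
    have hn : ((N + 1 : ℕ) : ℝ) = (m + omega * θ) / omega := by
      rw [eq_div_iff hw.ne', ← hyθ, hfr]; ring
    have hdiff : (1 : ℝ) / fl N - 1 / fl (N + 1) = 1 / ((m - 1) * m) := by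
      rw [hM, ← hmd, show (fl N : ℝ) = m - 1 by linarith]
      have : m - 1 ≠ 0 := by linarith
      field_simp
      ring
    -- The right side telescopes along the jumps of the floor.
    have hB : 1 / (m * (m + omega * θ)) ≤ 1 / ((m - 1) * m) := by
      apply one_div_le_one_div_of_le
      · exact mul_pos (by linarith) hm0
      · nlinarith [mul_nonneg hw.le hθ0]
    have hB0 : 0 < 1 / (m * (m + omega * θ)) := by positivity
    -- The new β-term 1/2 - θ carries weight ω/m instead of 1/(N+1) = ω/(m+ωθ); the error is 1/2 - θ
    -- times the difference of these weights.
    refine ⟨omega ^ 2 * ((1 / 2 - θ) * θ) * (1 / (m * (m + omega * θ))), ?_, ?_, ?_⟩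
    · rw [hM, T_succ, T_succ, hg, hu, ← hmd, hn]
      field_simp
      ring
    · rw [hdiff]
      have h1 : (1 / 2 - θ) * θ ≤ 1 / 16 := by nlinarith [sq_nonneg (θ - 1 / 4)]
      calc omega ^ 2 * ((1 / 2 - θ) * θ) * (1 / (m * (m + omega * θ)))
          ≤ omega ^ 2 * (1 / 16) * (1 / (m * (m + omega * θ))) := by gcongr
        _ ≤ omega ^ 2 * (1 / 16) * (1 / ((m - 1) * m)) := by gcongr
        _ = _ := by ring
    · rw [hdiff]
      have h1 : -(1 / 2) ≤ (1 / 2 - θ) * θ := by nlinarith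
      calc -(omega ^ 2 / 2 * (1 / ((m - 1) * m)))
          ≤ -(omega ^ 2 / 2 * (1 / (m * (m + omega * θ)))) := by
            rw [neg_le_neg_iff]; gcongr
        _ = omega ^ 2 * (-(1 / 2)) * (1 / (m * (m + omega * θ))) := by ring
        _ ≤ _ := by gcongr

/-- Abel summation of (g_{j+1} - g_j)/(j+1), measuring g from its upper bound 1/2 or its lower bound
-ω/8 so that every leftover term has a definite sign. -/
lemma T_renorm (N k : ℕ) (hN : 2 ≤ N) :
    (T (N + k) + omega * T (fl (N + k))) - (T N + omega * T (fl N)) ≤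
      (1 / 2 - gOrb N) / (N + 1) - (1 / 2 - gOrb (N + k)) / ((N + k : ℕ) + 1) +
        omega ^ 2 / 16 * (1 / fl N - 1 / fl (N + k)) ∧
    (-(omega / 8) - gOrb N) / (N + 1) - (-(omega / 8) - gOrb (N + k)) / ((N + k : ℕ) + 1) -
        omega ^ 2 / 2 * (1 / fl N - 1 / fl (N + k)) ≤
      (T (N + k) + omega * T (fl (N + k))) - (T N + omega * T (fl N)) := by
  induction k with
  | zero => simp
  | succ k ih =>
    obtain ⟨-, e, he, he1, he2⟩ := T_step (N + k) (by omega)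
    rw [← add_assoc]
    have hX : (0 : ℝ) < ((N + k : ℕ) : ℝ) + 1 := by positivity
    have hcast : ((N + k + 1 : ℕ) : ℝ) = ((N + k : ℕ) : ℝ) + 1 := by push_cast; ring
    rw [hcast] at he ⊢
    set X : ℝ := ((N + k : ℕ) : ℝ) + 1
    have hd : 1 / (X + 1) ≤ 1 / X := one_div_le_one_div_of_le hX (by linarith)
    have h1 := mul_le_mul_of_nonneg_left hd (sub_nonneg.2 (gOrb_le (N + k + 1)))
    have h2 := mul_le_mul_of_nonneg_left hd
      (by linarith [gOrb_ge (N + k + 1)] : 0 ≤ gOrb (N + k + 1) + omega / 8)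
    simp only [div_eq_mul_inv, one_mul] at he he1 he2 ih h1 h2 ⊢
    constructor <;> linarith [ih.1, ih.2]

lemma tendsto_fl : Tendsto fl atTop atTop :=
  tendsto_nat_floor_atTop.comp (tendsto_natCast_atTop_atTop.atTop_mul_const omega_pos)

/-- T(N) + ωT(⌊Nω⌋) tends to (1+ω)τ = τ/ω. Solving for τ - T(N) leaves the computable difference
T(N) - T(⌊Nω⌋). -/
lemma tail_T_bounds {τ : ℝ} (hτ : Tendsto T atTop (𝓝 τ)) (N : ℕ) (hN : 2 ≤ N) :
    τ - T N ≤ omega * ((1 / 2 - gOrb N) / (N + 1) + omega ^ 2 / 16 * (1 / fl N) -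
      omega * (T N - T (fl N))) ∧
    omega * ((-(omega / 8) - gOrb N) / (N + 1) - omega ^ 2 / 2 * (1 / fl N) -
      omega * (T N - T (fl N))) ≤ τ - T N := by
  have hw := omega_pos
  have hlim : Tendsto (fun k => (T (N + k) + omega * T (fl (N + k))) - (T N + omega * T (fl N)))
      atTop (𝓝 ((τ + omega * τ) - (T N + omega * T (fl N)))) := by
    have hk : Tendsto (fun k => N + k) atTop atTop := tendsto_atTop_mono (fun k => Nat.le_add_left k N) tendsto_id
    exact ((hτ.comp hk).add (((hτ.comp tendsto_fl).comp hk).const_mul omega)).sub_const _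
  have h1 : (τ + omega * τ) - (T N + omega * T (fl N)) ≤
      (1 / 2 - gOrb N) / (N + 1) + omega ^ 2 / 16 * (1 / fl N) := by
    refine le_of_tendsto hlim (Eventually.of_forall fun k => (T_renorm N k hN).1.trans ?_)
    have ha : 0 ≤ (1 / 2 - gOrb (N + k)) / ((N + k : ℕ) + 1) :=
      div_nonneg (sub_nonneg.2 (gOrb_le _)) (by positivity)
    have hb : 0 ≤ omega ^ 2 / 16 * (1 / (fl (N + k) : ℝ)) := by positivity
    linarith
  have h2 : (-(omega / 8) - gOrb N) / (N + 1) - omega ^ 2 / 2 * (1 / fl N) ≤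
      (τ + omega * τ) - (T N + omega * T (fl N)) := by
    refine ge_of_tendsto hlim (Eventually.of_forall fun k => le_trans ?_ (T_renorm N k hN).2)
    have ha : (-(omega / 8) - gOrb (N + k)) / ((N + k : ℕ) + 1) ≤ 0 :=
      div_nonpos_of_nonpos_of_nonneg (by linarith [gOrb_ge (N + k)]) (by positivity)
    have hb : 0 ≤ omega ^ 2 / 2 * (1 / (fl (N + k) : ℝ)) := by positivity
    linarith
  have e : τ - T N = omega * (((τ + omega * τ) - (T N + omega * T (fl N))) -
      omega * (T N - T (fl N))) := by
    linear_combination (T N - τ) * omega_mul_one_add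
  rw [e]
  constructor
  · gcongr
  · gcongr

/-! ### Tail of the infinite product -/

/-- The factors of `G`. -/
noncomputable def f (t : ℕ) : ℝ := bLim t ^ 2 * (1 - ratioLim t ^ 2)

lemma f_pos (t : ℕ) (ht : 1 ≤ t) : 0 < f t := by
  have := bLim_ge t ht
  have := ratioLim_sq_lt t ht
  exact mul_pos (by positivity) (by linarith)

/-- With r = 1/(√5 t), f is (1 - xr)(1 + (1-x)r). The first-order terms give -(2/√5)u_t/t; the
second-order ones are at most r²/2 = 0.1/t² as x² + (1-x)² ≤ 1, and the last 0.0001 absorbs the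
cubic remainder. -/
lemma log_f_bounds (t : ℕ) (ht : 8192 ≤ t) :
    Real.log (f t) ≤ -(2 / Real.sqrt 5) * (u omega t / t) ∧
    -(2 / Real.sqrt 5) * (u omega t / t) - 0.1001 * (1 / (t : ℝ) ^ 2) ≤ Real.log (f t) := by
  have h5 : (0 : ℝ) < Real.sqrt 5 := by positivity
  have ht0 : (8192 : ℝ) ≤ t := by exact_mod_cast ht
  have htp : (0 : ℝ) < t := by linarith
  have hx0 := Int.fract_nonneg ((t : ℝ) * omega)
  have hx1 := Int.fract_lt_one ((t : ℝ) * omega)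
  have hu : -(2 / Real.sqrt 5) * (u omega t / t) =
      (1 - 2 * Int.fract ((t : ℝ) * omega)) * (1 / Real.sqrt 5 / t) := by
    rw [u]; field_simp; ring
  have hr2 : (1 / Real.sqrt 5 / (t : ℝ)) ^ 2 = 1 / 5 * (1 / (t : ℝ) ^ 2) := by
    rw [div_pow, div_pow, Real.sq_sqrt (by norm_num)]; ring
  have hr0 : 0 < 1 / Real.sqrt 5 / (t : ℝ) := by positivity
  have hr1 : 1 / Real.sqrt 5 / (t : ℝ) ≤ 1 / 8192 := by
    have h := inv_sqrt_five_bounds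
    rw [div_le_iff₀ htp]; linarith
  rw [hu, f, bLim_sq_mul t (by omega)]
  set x := Int.fract ((t : ℝ) * omega)
  set r := 1 / Real.sqrt 5 / (t : ℝ)
  have hxr : x * r ≤ 1 / 8192 := by nlinarith
  have hxr0 : 0 ≤ x * r := by positivity
  have hyr : (1 - x) * r ≤ 1 / 8192 := by nlinarith
  have hyr0 : 0 ≤ (1 - x) * r := mul_nonneg (by linarith) hr0.le
  have p1 : 0 < 1 - x * r := by linarith
  have p2 : 0 < 1 + (1 - x) * r := by linarith
  rw [Real.log_mul p1.ne' p2.ne']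
  have q1 : ∀ z : ℝ, |z| ≤ 1 / 8192 → -z - z ^ 2 / 2 - z ^ 2 / 4096 ≤ Real.log (1 - z) := by
    intro z hz
    have h := Real.abs_log_sub_add_sum_range_le (by linarith : |z| < 1) 2
    rw [Finset.sum_range_succ, Finset.sum_range_one] at h
    norm_num at h
    have h3 : |z| ^ 3 / (1 - |z|) ≤ z ^ 2 / 4096 := by
      rw [div_le_iff₀ (by linarith), ← sq_abs]
      nlinarith [mul_nonneg (sq_nonneg |z|) (sub_nonneg.2 hz), sq_nonneg |z|]
    linarith [(abs_le.1 h).1]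
  constructor
  · linarith [Real.log_le_sub_one_of_pos p1, Real.log_le_sub_one_of_pos p2]
  · have a1 := q1 (x * r) (by rw [abs_of_nonneg hxr0]; exact hxr)
    have a2 := q1 (-((1 - x) * r)) (by rw [abs_neg, abs_of_nonneg hyr0]; exact hyr)
    rw [sub_neg_eq_add] at a2
    have hs : x ^ 2 + (1 - x) ^ 2 ≤ 1 := by nlinarith
    have hs2 : (x ^ 2 + (1 - x) ^ 2) * r ^ 2 ≤ 1 * (1 / 5 * (1 / (t : ℝ) ^ 2)) := by
      rw [hr2]; gcongr
    have hp : 0 ≤ 1 / (t : ℝ) ^ 2 := by positivity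
    nlinarith

lemma G_eq_prod (N : ℕ) : G N = ∏ t ∈ Finset.range N, f (t + 1) := rfl

lemma G_pos (N : ℕ) : 0 < G N := Finset.prod_pos fun t _ => f_pos (t + 1) (by omega)

lemma log_G_tail (N k : ℕ) (hN : 8192 ≤ N) :
    Real.log (G (N + k)) - Real.log (G N) ≤ -(2 / Real.sqrt 5) * (T (N + k) - T N) ∧
    -(2 / Real.sqrt 5) * (T (N + k) - T N) - 0.1001 * (1 / N - 1 / ((N + k : ℕ) : ℝ)) ≤
      Real.log (G (N + k)) - Real.log (G N) := by
  induction k with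
  | zero => simp
  | succ k ih =>
    rw [← add_assoc, T_succ, G_eq_prod (N + k + 1), Finset.prod_range_succ, ← G_eq_prod,
      Real.log_mul (G_pos _).ne' (f_pos _ (by omega)).ne']
    have h := log_f_bounds (N + k + 1) (by omega)
    have hX : (0 : ℝ) < ((N + k : ℕ) : ℝ) := by
      have : 0 < N + k := by omega
      exact_mod_cast this
    have h2 : 1 / ((N + k + 1 : ℕ) : ℝ) ^ 2 ≤
        1 / ((N + k : ℕ) : ℝ) - 1 / ((N + k + 1 : ℕ) : ℝ) := by
      rw [show ((N + k + 1 : ℕ) : ℝ) = ((N + k : ℕ) : ℝ) + 1 by push_cast; ring,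
        div_sub_div _ _ hX.ne' (by positivity), div_le_div_iff₀ (by positivity) (by positivity)]
      nlinarith
    constructor <;> linarith [ih.1, ih.2, h.1, h.2]

lemma log_G_limit_bounds {τ γ : ℝ} (hτ : Tendsto T atTop (𝓝 τ)) (hγ : 0 < γ)
    (hG : Tendsto G atTop (𝓝 γ)) (N : ℕ) (hN : 8192 ≤ N) :
    Real.log γ - Real.log (G N) ≤ -(2 / Real.sqrt 5) * (τ - T N) ∧
    -(2 / Real.sqrt 5) * (τ - T N) - 0.1001 * (1 / N) ≤ Real.log γ - Real.log (G N) := by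
  have hk : Tendsto (fun k => N + k) atTop atTop := tendsto_atTop_mono (fun k => Nat.le_add_left k N) tendsto_id
  have h1 : Tendsto (fun k => Real.log (G (N + k)) - Real.log (G N)) atTop
      (𝓝 (Real.log γ - Real.log (G N))) := ((hG.comp hk).log hγ.ne').sub_const _
  have h2 : Tendsto (fun k => -(2 / Real.sqrt 5) * (T (N + k) - T N)) atTop
      (𝓝 (-(2 / Real.sqrt 5) * (τ - T N))) := ((hτ.comp hk).sub_const _).const_mul _
  refine ⟨le_of_tendsto_of_tendsto' h1 h2 fun k => (log_G_tail N k hN).1,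
    le_of_tendsto_of_tendsto' (h2.sub_const _) h1 fun k => le_trans ?_ (log_G_tail N k hN).2⟩
  have : 0 ≤ 1 / ((N + k : ℕ) : ℝ) := by positivity
  linarith


/-! ### Certified integer evaluation of the first 8192 = 2^13 terms -/

/-- A lower bound for `∏_{n ≤ t < n + 2^d} a t / s`, in units of `1 / s`. -/
def prodLower (s : ℕ) (a : ℕ → ℕ) : ℕ → ℕ → ℕ
  | 0, n => a n
  | d + 1, n => prodLower s a d n * prodLower s a d (n + 2 ^ d) / s

/-- An upper bound for `∏_{n ≤ t < n + 2^d} a t / s`, in units of `1 / s`. -/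
def prodUpper (s : ℕ) (a : ℕ → ℕ) : ℕ → ℕ → ℕ
  | 0, n => a n
  | d + 1, n => prodUpper s a d n * prodUpper s a d (n + 2 ^ d) / s + 1

/-- The sum `∑_{n ≤ t < n + 2^d} a t`, by bisection. -/
def sumTree (a : ℕ → ℕ) : ℕ → ℕ → ℕ
  | 0, n => a n
  | d + 1, n => sumTree a d n + sumTree a d (n + 2 ^ d)

lemma prodLower_le {s : ℕ} (hs : 0 < s) (a : ℕ → ℕ) (F : ℕ → ℝ) (d n : ℕ)
    (h : ∀ i < 2 ^ d, (a (n + i) : ℝ) / s ≤ F (n + i)) :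
    (prodLower s a d n : ℝ) / s ≤ ∏ i ∈ Finset.range (2 ^ d), F (n + i) := by
  have hs' : (0 : ℝ) < s := by exact_mod_cast hs
  induction d generalizing n with
  | zero => simpa [prodLower] using h 0 (by norm_num)
  | succ d ih =>
    have h1 := ih n fun i hi => h i (hi.trans (by rw [pow_succ]; omega))
    have h2 := ih (n + 2 ^ d) fun i hi => by
      rw [add_assoc]; exact h (2 ^ d + i) (by rw [pow_succ]; omega)
    rw [pow_succ, mul_two, Finset.prod_range_add, prodLower]
    calc ((prodLower s a d n * prodLower s a d (n + 2 ^ d) / s : ℕ) : ℝ) / s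
        ≤ ((prodLower s a d n * prodLower s a d (n + 2 ^ d) : ℕ) / (s : ℝ)) / s := by
          gcongr; exact Nat.cast_div_le
      _ = (prodLower s a d n / (s : ℝ)) * (prodLower s a d (n + 2 ^ d) / s) := by
          push_cast; field_simp
      _ ≤ (∏ i ∈ Finset.range (2 ^ d), F (n + i)) *
          ∏ i ∈ Finset.range (2 ^ d), F (n + 2 ^ d + i) :=
          mul_le_mul h1 h2 (by positivity) ((by positivity : (0 : ℝ) ≤ _).trans h1)
      _ = _ := by simp only [add_assoc]

lemma le_prodUpper {s : ℕ} (hs : 0 < s) (a : ℕ → ℕ) (F : ℕ → ℝ) (d n : ℕ)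
    (h0 : ∀ i < 2 ^ d, 0 ≤ F (n + i)) (h : ∀ i < 2 ^ d, F (n + i) ≤ (a (n + i) : ℝ) / s) :
    ∏ i ∈ Finset.range (2 ^ d), F (n + i) ≤ (prodUpper s a d n : ℝ) / s := by
  have hs' : (0 : ℝ) < s := by exact_mod_cast hs
  induction d generalizing n with
  | zero => simpa [prodUpper] using h 0 (by norm_num)
  | succ d ih =>
    have e2 : ∀ i < 2 ^ d, 2 ^ d + i < 2 ^ (d + 1) := fun i hi => by rw [pow_succ]; omega
    have e1 : ∀ i < 2 ^ d, i < 2 ^ (d + 1) := fun i hi => by rw [pow_succ]; omega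
    have h1 := ih n (fun i hi => h0 i (e1 i hi)) fun i hi => h i (e1 i hi)
    have h2 := ih (n + 2 ^ d) (fun i hi => by rw [add_assoc]; exact h0 _ (e2 i hi))
      fun i hi => by rw [add_assoc]; exact h _ (e2 i hi)
    rw [pow_succ, mul_two, Finset.prod_range_add, prodUpper]
    have hfl : ((prodUpper s a d n * prodUpper s a d (n + 2 ^ d) : ℕ) : ℝ) / s ≤
        ((prodUpper s a d n * prodUpper s a d (n + 2 ^ d) / s + 1 : ℕ) : ℝ) := by
      rw [div_le_iff₀' hs']
      have := Nat.lt_mul_div_succ (prodUpper s a d n * prodUpper s a d (n + 2 ^ d)) hs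
      exact_mod_cast this.le
    calc (∏ i ∈ Finset.range (2 ^ d), F (n + i)) *
          ∏ i ∈ Finset.range (2 ^ d), F (n + (2 ^ d + i))
        ≤ (prodUpper s a d n / (s : ℝ)) * (prodUpper s a d (n + 2 ^ d) / s) := by
          simp only [← add_assoc]
          refine mul_le_mul h1 h2 (Finset.prod_nonneg fun i hi => ?_) (by positivity)
          rw [add_assoc]
          exact h0 _ (e2 i (Finset.mem_range.1 hi))
      _ = (((prodUpper s a d n * prodUpper s a d (n + 2 ^ d) : ℕ) : ℝ) / s) / s := by
          push_cast; field_simp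
      _ ≤ _ := by gcongr

lemma sumTree_eq (a : ℕ → ℕ) (d n : ℕ) :
    sumTree a d n = ∑ i ∈ Finset.range (2 ^ d), a (n + i) := by
  induction d generalizing n with
  | zero => simp [sumTree]
  | succ d ih =>
    rw [sumTree, ih, ih, pow_succ, mul_two, Finset.sum_range_add]
    simp only [add_assoc]

/-- The fraction is F_40/F_41, a convergent from below. The factor 8193 keeps the error of nω below
one unit 1/F_41 for every n in use. -/
lemma omega_convergent_bounds : (102334155 : ℝ) / 165580141 ≤ omega ∧
    omega ≤ 102334155 / 165580141 + 1 / (8193 * 165580141) := by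
  constructor
  · by_contra h
    nlinarith [omega_sq, omega_pos]
  · by_contra h
    nlinarith [omega_sq, omega_pos]

lemma natCast_mul_convergent (n : ℕ) : (n : ℝ) * (102334155 / 165580141) =
    (n * 102334155 / 165580141 : ℕ) + ((n * 102334155 % 165580141 : ℕ) : ℝ) / 165580141 := by
  have h : (165580141 : ℝ) * ((n * 102334155 / 165580141 : ℕ) : ℝ) +
      ((n * 102334155 % 165580141 : ℕ) : ℝ) = n * 102334155 := by
    exact_mod_cast Nat.div_add_mod (n * 102334155) 165580141
  rw [← mul_div_assoc, ← h]
  ring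

lemma natCast_mul_omega_bounds (n : ℕ) (hn : n ≤ 8193) :
    (n : ℝ) * (102334155 / 165580141) ≤ n * omega ∧
    n * omega ≤ (n : ℝ) * (102334155 / 165580141) + 1 / 165580141 := by
  have h := omega_convergent_bounds
  have hn' : (n : ℝ) ≤ 8193 := by exact_mod_cast hn
  have hn0 : (0 : ℝ) ≤ n := by positivity
  constructor <;> nlinarith [h.1, h.2]

lemma fl_eq (n : ℕ) (hn : n ≤ 8192) : fl n = n * 102334155 / 165580141 := by
  have hlt : (n : ℝ) * omega < (n * 102334155 / 165580141 : ℕ) + 1 := by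
    have hr : ((n * 102334155 % 165580141 : ℕ) : ℝ) + 1 ≤ 165580141 := by
      exact_mod_cast Nat.mod_lt (n * 102334155) (by norm_num)
    have hn' : (n : ℝ) ≤ 8192 := by exact_mod_cast hn
    have hn0 : (0 : ℝ) ≤ n := by positivity
    have h1 := natCast_mul_convergent n
    have h2 := mul_le_mul_of_nonneg_left omega_convergent_bounds.2 hn0
    rw [mul_add] at h2
    have h3 : (n : ℝ) * (1 / (8193 * 165580141)) < 1 / 165580141 := by
      rw [mul_one_div, div_lt_div_iff₀ (by norm_num) (by norm_num)]
      linarith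
    have h4 : ((n * 102334155 % 165580141 : ℕ) : ℝ) / 165580141 + 1 / 165580141 ≤ 1 := by
      rw [← add_div, div_le_one (by norm_num)]; exact hr
    linarith
  have hge : ((n * 102334155 / 165580141 : ℕ) : ℝ) ≤ n * omega := by
    have h1 := natCast_mul_convergent n
    have h2 := (natCast_mul_omega_bounds n (by omega)).1
    have h3 : (0 : ℝ) ≤ ((n * 102334155 % 165580141 : ℕ) : ℝ) / 165580141 := by positivity
    linarith
  exact (Nat.floor_eq_iff (mul_nonneg (Nat.cast_nonneg _) omega_pos.le)).2 ⟨hge, hlt⟩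

lemma fract_bounds (n : ℕ) (hn : n ≤ 8192) :
    ((n * 102334155 % 165580141 : ℕ) : ℝ) / 165580141 ≤ Int.fract ((n : ℝ) * omega) ∧
    Int.fract ((n : ℝ) * omega) ≤
      ((n * 102334155 % 165580141 : ℕ) : ℝ) / 165580141 + 1 / 165580141 := by
  rw [fract_mul_omega, fl_eq n hn]
  have h1 := natCast_mul_convergent n
  have h2 := natCast_mul_omega_bounds n (by omega)
  constructor <;> linarith [h2.1, h2.2]

/-- Uses √5 = 1 + 2ω to remove the square root; with the floor known, the expression is increasing
in ω, so rational bounds for ω transfer directly. -/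
lemma f_eq (t : ℕ) (ht : 1 ≤ t) :
    f t = (t + t * omega + fl t) * (t + t * omega + fl t + 1) / (5 * (t : ℝ) ^ 2) := by
  have h5 : Real.sqrt 5 ^ 2 = 5 := Real.sq_sqrt (by norm_num)
  have h5' : Real.sqrt 5 ≠ 0 := by positivity
  have ht0 : (t : ℝ) ≠ 0 := by positivity
  rw [f, bLim_sq_mul t ht, fract_mul_omega]
  have e : (t : ℝ) + t * omega + fl t = Real.sqrt 5 * t - (t * omega - fl t) := by
    rw [sqrt_five_eq]; ring
  rw [e]
  nth_rw 5 [← h5]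
  field_simp
  ring

/-- Lower bounds for `f`, in units of `10⁻²⁰`. -/
def fLower (n : ℕ) : ℕ :=
  (165580141 * (n + n * 102334155 / 165580141) + 102334155 * n) *
    (165580141 * (n + n * 102334155 / 165580141 + 1) + 102334155 * n) * 10 ^ 20 /
      (5 * n ^ 2 * 165580141 ^ 2)

/-- Upper bounds for `f`, in units of `10⁻²⁰`. -/
def fUpper (n : ℕ) : ℕ :=
  (165580141 * (n + n * 102334155 / 165580141) + 102334155 * n + 1) *
    (165580141 * (n + n * 102334155 / 165580141 + 1) + 102334155 * n + 1) * 10 ^ 20 /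
      (5 * n ^ 2 * 165580141 ^ 2) + 1

lemma fLower_le (n : ℕ) (h1 : 1 ≤ n) (hn : n ≤ 8192) :
    (fLower n : ℝ) / ((10 ^ 20 : ℕ) : ℝ) ≤ f n := by
  have hn0 : (0 : ℝ) < n := by exact_mod_cast h1
  have h2 := (natCast_mul_omega_bounds n (by omega)).1
  rw [f_eq n h1, fl_eq n hn, fLower]
  set m := n * 102334155 / 165580141
  calc _ ≤ (((165580141 * (n + m) + 102334155 * n) *
          (165580141 * (n + m + 1) + 102334155 * n) * 10 ^ 20 : ℕ) : ℝ) /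
          ((5 * n ^ 2 * 165580141 ^ 2 : ℕ) : ℝ) / ((10 ^ 20 : ℕ) : ℝ) := by
        gcongr; exact Nat.cast_div_le
    _ = ((n : ℝ) + n * (102334155 / 165580141) + m) *
          (n + n * (102334155 / 165580141) + m + 1) / (5 * (n : ℝ) ^ 2) := by
        push_cast; field_simp; ring
    _ ≤ _ := by
        have hw := omega_pos
        gcongr

lemma f_le_fUpper (n : ℕ) (h1 : 1 ≤ n) (hn : n ≤ 8192) :
    f n ≤ (fUpper n : ℝ) / ((10 ^ 20 : ℕ) : ℝ) := by
  have hn0 : (0 : ℝ) < n := by exact_mod_cast h1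
  have hw := omega_pos
  have h2 := (natCast_mul_omega_bounds n (by omega)).2
  rw [f_eq n h1, fl_eq n hn, fUpper]
  set m := n * 102334155 / 165580141
  have hfl : ∀ a b : ℕ, 0 < b → (a : ℝ) / b ≤ ((a / b + 1 : ℕ) : ℝ) := fun a b hb => by
    have hb' : (0 : ℝ) < b := by exact_mod_cast hb
    rw [div_le_iff₀' hb']
    exact_mod_cast (Nat.lt_mul_div_succ a hb).le
  calc _ ≤ ((n : ℝ) + (n * (102334155 / 165580141) + 1 / 165580141) + m) *
          (n + (n * (102334155 / 165580141) + 1 / 165580141) + m + 1) / (5 * (n : ℝ) ^ 2) := by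
        gcongr
    _ = (((165580141 * (n + m) + 102334155 * n + 1) *
          (165580141 * (n + m + 1) + 102334155 * n + 1) * 10 ^ 20 : ℕ) : ℝ) /
          ((5 * n ^ 2 * 165580141 ^ 2 : ℕ) : ℝ) / ((10 ^ 20 : ℕ) : ℝ) := by
        push_cast; field_simp; ring
    _ ≤ _ := by
        refine div_le_div_of_nonneg_right (hfl _ _ (by positivity)) (by positivity)

/-- Lower bounds for `u_n / n + 1` when `n > 5062`, in units of `10⁻²⁰`. -/
def uLower (n : ℕ) : ℕ :=
  if n ≤ 5062 then 0 else
    (2 * (n * 102334155 % 165580141) + 165580141 * (2 * n - 1)) * 10 ^ 20 / (2 * 165580141 * n)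

lemma uLower_bounds (n : ℕ) (h1 : 5062 < n) (hn : n ≤ 8192) :
    (uLower n : ℝ) / 10 ^ 20 ≤ u omega n / n + 1 ∧
    u omega n / n + 1 ≤ (uLower n : ℝ) / 10 ^ 20 + 1 / 10 ^ 10 := by
  have hn0 : (5062 : ℝ) < n := by exact_mod_cast h1
  have hnp : (0 : ℝ) < n := by linarith
  have hb := fract_bounds n hn
  rw [uLower, if_neg (by omega), u]
  set x := Int.fract ((n : ℝ) * omega)
  set r := n * 102334155 % 165580141
  set a := (2 * r + 165580141 * (2 * n - 1)) * 10 ^ 20 with ha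
  set b := 2 * 165580141 * n with hbd
  have hb0 : 0 < b := by positivity
  have hab : (a : ℝ) / b / 10 ^ 20 = ((r : ℝ) / 165580141 - 1 / 2) / n + 1 := by
    rw [ha, hbd]
    push_cast [Nat.cast_sub (by omega : 1 ≤ 2 * n)]
    field_simp
    ring
  have hl : ((a / b : ℕ) : ℝ) ≤ (a : ℝ) / b := Nat.cast_div_le
  have hu : (a : ℝ) / b ≤ ((a / b : ℕ) : ℝ) + 1 := by
    have hb' : (0 : ℝ) < b := by exact_mod_cast hb0
    rw [div_le_iff₀' hb']
    exact_mod_cast (Nat.lt_mul_div_succ a hb0).le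
  constructor
  · calc ((a / b : ℕ) : ℝ) / 10 ^ 20 ≤ (a : ℝ) / b / 10 ^ 20 := by gcongr
      _ = ((r : ℝ) / 165580141 - 1 / 2) / n + 1 := hab
      _ ≤ (x - 1 / 2) / n + 1 := by gcongr; exact hb.1
  · calc (x - 1 / 2) / n + 1 ≤ ((r : ℝ) / 165580141 + 1 / 165580141 - 1 / 2) / n + 1 := by
          gcongr; exact hb.2
      _ = ((r : ℝ) / 165580141 - 1 / 2) / n + 1 + 1 / 165580141 / n := by ring
      _ ≤ ((r : ℝ) / 165580141 - 1 / 2) / n + 1 + 1 / 165580141 / 5062 := by gcongr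
      _ = (a : ℝ) / b / 10 ^ 20 + 1 / 165580141 / 5062 := by rw [hab]
      _ ≤ (((a / b : ℕ) : ℝ) + 1) / 10 ^ 20 + 1 / 165580141 / 5062 := by gcongr
      _ ≤ _ := by rw [add_div, add_assoc]; gcongr; norm_num

lemma fl_8192 : fl 8192 = 5062 := by rw [fl_eq 8192 le_rfl]

/-- Each of the 3130 = 8192 - 5062 terms is shifted by 1 to stay in the naturals. The terms up to
5062 = ⌊8192ω⌋ are set to 0, so the sum fills a full binary tree. -/
lemma T_diff_bounds : (sumTree uLower 13 1 : ℝ) / 10 ^ 20 ≤ T 8192 - T 5062 + 3130 ∧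
    T 8192 - T 5062 + 3130 ≤ (sumTree uLower 13 1 : ℝ) / 10 ^ 20 + 3130 / 10 ^ 10 := by
  have e1 : T 8192 - T 5062 + 3130 =
      ∑ i ∈ Finset.range 3130, (u omega (5062 + i + 1) / ((5062 + i + 1 : ℕ) : ℝ) + 1) := by
    rw [Finset.sum_add_distrib, T, T, show 8192 = 5062 + 3130 from rfl, Finset.sum_range_add]
    simp
  have e2 : (sumTree uLower 13 1 : ℝ) / 10 ^ 20 =
      ∑ i ∈ Finset.range 3130, (uLower (5062 + i + 1) : ℝ) / 10 ^ 20 := by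
    rw [sumTree_eq, show 2 ^ 13 = 5062 + 3130 by norm_num, Finset.sum_range_add,
      Finset.sum_eq_zero, zero_add, Nat.cast_sum, Finset.sum_div]
    · exact Finset.sum_congr rfl fun i _ => by rw [add_comm 1]
    · intro i hi
      have := Finset.mem_range.1 hi
      rw [uLower, if_pos (by omega)]
  have e3 : (3130 : ℝ) / 10 ^ 10 = ∑ i ∈ Finset.range 3130, (1 : ℝ) / 10 ^ 10 := by
    rw [Finset.sum_const, Finset.card_range, nsmul_eq_mul]; norm_num
  rw [e1, e2, e3, ← Finset.sum_add_distrib]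
  constructor
  · refine Finset.sum_le_sum fun i hi => ?_
    have := Finset.mem_range.1 hi
    exact (uLower_bounds _ (by omega) (by omega)).1
  · refine Finset.sum_le_sum fun i hi => ?_
    have := Finset.mem_range.1 hi
    exact (uLower_bounds _ (by omega) (by omega)).2

lemma G_bounds : (prodLower (10 ^ 20) fLower 13 1 : ℝ) / ((10 ^ 20 : ℕ) : ℝ) ≤ G 8192 ∧
    G 8192 ≤ (prodUpper (10 ^ 20) fUpper 13 1 : ℝ) / ((10 ^ 20 : ℕ) : ℝ) := by
  have e : G 8192 = ∏ i ∈ Finset.range (2 ^ 13), f (1 + i) := by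
    rw [G_eq_prod]
    exact Finset.prod_congr rfl fun i _ => by rw [add_comm]
  rw [e]
  constructor
  · exact prodLower_le (by norm_num) _ _ _ _ fun i hi => fLower_le _ (by omega) (by omega)
  · exact le_prodUpper (by norm_num) _ _ _ _ (fun i hi => (f_pos _ (by omega)).le)
      fun i hi => f_le_fUpper _ (by omega) (by omega)

set_option maxRecDepth 10000 in
lemma prodLower_value : 85657100000000000000 ≤ prodLower (10 ^ 20) fLower 13 1 := by
  decide +kernel

set_option maxRecDepth 10000 in
lemma prodUpper_value : prodUpper (10 ^ 20) fUpper 13 1 ≤ 85657200000000000000 := by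
  decide +kernel

set_option maxRecDepth 10000 in
lemma sumTree_value : 313000021200000000000000 ≤ sumTree uLower 13 1 ∧
    sumTree uLower 13 1 ≤ 313000021300000000000000 := by
  decide +kernel

/-! ### Numerical enclosure of the limit -/

lemma gOrb_8192 : 0.4176 ≤ gOrb 8192 ∧ gOrb 8192 ≤ 0.4177 := by
  have h := fract_bounds 8192 le_rfl
  norm_num at h
  have h1 := omega_gt
  have h2 := omega_lt
  have hw := omega_convergent_bounds
  rw [gOrb, g]
  norm_num
  set x := Int.fract ((8192 : ℝ) * omega)
  have hx1 : 0.934435 ≤ x := by linarith [h.1]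
  have hx2 : x ≤ 0.934436 := by linarith [h.2]
  have hw1 : 0.618033 ≤ omega := by linarith [hw.1]
  have hw2 : omega ≤ 0.618034 := by linarith [hw.2]
  constructor <;> nlinarith

lemma T_tail_8192 {τ : ℝ} (hτ : Tendsto T atTop (𝓝 τ)) :
    τ - T 8192 ≤ -0.0000715 ∧ -0.00015 ≤ τ - T 8192 := by
  obtain ⟨h1, h2⟩ := tail_T_bounds hτ 8192 (by norm_num)
  rw [fl_8192] at h1 h2
  obtain ⟨hD1, hD2⟩ := T_diff_bounds
  obtain ⟨hs1, hs2⟩ := sumTree_value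
  have hs1' : (313000021200000000000000 : ℝ) ≤ sumTree uLower 13 1 := by exact_mod_cast hs1
  have hs2' : (sumTree uLower 13 1 : ℝ) ≤ 313000021300000000000000 := by exact_mod_cast hs2
  obtain ⟨hg1, hg2⟩ := gOrb_8192
  have hw := omega_convergent_bounds
  have hw1 : 0.618033 ≤ omega := by linarith [hw.1]
  have hw2 : omega ≤ 0.618034 := by linarith [hw.2]
  have hwsq := omega_sq
  have hDl : 0.000212 ≤ T 8192 - T 5062 := by linarith
  have hDu : T 8192 - T 5062 ≤ 0.000214 := by linarith
  generalize T 8192 - T 5062 = D at *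
  have hD0 : 0 ≤ D := by linarith
  have hw0 := omega_pos
  have hwD1 : 0.618033 * 0.000212 ≤ omega * D := by gcongr
  have hwD2 : omega * D ≤ 0.618034 * 0.000214 := by gcongr
  push_cast at h1 h2
  norm_num at h1 h2 hwD1 hwD2
  constructor
  · nlinarith
  · nlinarith

/-- The truncated product gives only about 2.4069, below 2.407, so a strictly positive lower bound
for the logarithm of the tail is essential. -/
theorem limit_bounds {γ : ℝ} (hγ : 0 < γ) (hG : Tendsto G atTop (𝓝 γ)) :
    2.407 ≤ 2 * Real.pi / Real.sqrt 5 * γ ∧ 2 * Real.pi / Real.sqrt 5 * γ < 2.408 := by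
  obtain ⟨τ, hτ⟩ := exists_tendsto_T
  obtain ⟨hl, hu⟩ := log_G_limit_bounds hτ hγ hG 8192 le_rfl |>.symm
  obtain ⟨hR1, hR2⟩ := T_tail_8192 hτ
  have hGb1 : 0.856571 ≤ G 8192 :=
    calc (0.856571 : ℝ) = ((85657100000000000000 : ℕ) : ℝ) / ((10 ^ 20 : ℕ) : ℝ) := by norm_num
      _ ≤ (prodLower (10 ^ 20) fLower 13 1 : ℝ) / ((10 ^ 20 : ℕ) : ℝ) :=
        div_le_div_of_nonneg_right (Nat.cast_le.2 prodLower_value) (Nat.cast_nonneg _)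
      _ ≤ G 8192 := G_bounds.1
  have hGb2 : G 8192 ≤ 0.856572 :=
    calc G 8192 ≤ (prodUpper (10 ^ 20) fUpper 13 1 : ℝ) / ((10 ^ 20 : ℕ) : ℝ) := G_bounds.2
      _ ≤ ((85657200000000000000 : ℕ) : ℝ) / ((10 ^ 20 : ℕ) : ℝ) :=
        div_le_div_of_nonneg_right (Nat.cast_le.2 prodUpper_value) (Nat.cast_nonneg _)
      _ = 0.856572 := by norm_num
  have h51 : 2.236067 ≤ Real.sqrt 5 := Real.le_sqrt_of_sq_le (by norm_num)
  have h52 : Real.sqrt 5 ≤ 2.236068 := Real.sqrt_le_iff.2 ⟨by norm_num, by norm_num⟩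
  have h5p : 0 < Real.sqrt 5 := by linarith
  have hc1 : 0.8944 ≤ 2 / Real.sqrt 5 := by rw [le_div_iff₀ h5p]; linarith
  have hc2 : 2 / Real.sqrt 5 ≤ 0.8945 := by rw [div_le_iff₀ h5p]; linarith
  have hpi1 := Real.pi_gt_d6
  have hpi2 := Real.pi_lt_d6
  have hG0 := G_pos 8192
  have hexp : γ = G 8192 * Real.exp (Real.log γ - Real.log (G 8192)) := by
    rw [Real.exp_sub, Real.exp_log hγ, Real.exp_log hG0]; field_simp
  generalize Real.log γ - Real.log (G 8192) = y at *
  generalize G 8192 = G₀ at *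
  -- 0.8944 · 0.0000715 minus the quadratic loss 0.1001/8192.
  have hy1 : 0.0000516 ≤ y := by
    norm_num at hl
    nlinarith
  have hy2 : y ≤ 0.00014 := by nlinarith
  have he1 : 1.0000516 ≤ Real.exp y := by linarith [Real.add_one_le_exp y]
  have he2 : Real.exp y ≤ 1.0002 := by
    have h := Real.one_sub_le_exp_neg y
    rw [Real.exp_neg] at h
    have hp := Real.exp_pos y
    have h1 : Real.exp y * (1 - y) ≤ 1 := by
      calc Real.exp y * (1 - y) ≤ Real.exp y * (Real.exp y)⁻¹ := by gcongr
        _ = 1 := mul_inv_cancel₀ hp.ne'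
    nlinarith
  have hγ1 : 0.856571 * 1.0000516 ≤ γ := by rw [hexp]; gcongr
  have hγ2 : γ ≤ 0.856572 * 1.0002 := by rw [hexp]; gcongr
  rw [div_mul_eq_mul_div]
  constructor
  · rw [le_div_iff₀ h5p]
    calc (2.407 : ℝ) * Real.sqrt 5 ≤ 2.407 * 2.236068 := by gcongr
      _ ≤ 2 * 3.141592 * (0.856571 * 1.0000516) := by norm_num
      _ ≤ 2 * Real.pi * γ := by gcongr
  · rw [div_lt_iff₀ h5p]
    calc 2 * Real.pi * γ ≤ 2 * 3.141593 * (0.856572 * 1.0002) := by gcongr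
      _ < 2.408 * 2.236067 := by norm_num
      _ ≤ 2.408 * Real.sqrt 5 := by gcongr

theorem P_fib_eq_Q (n : ℕ) : P (Nat.fib n) omega = Q n := by
  rw [P, Q, Finset.abs_prod]

end Sudler

theorem mainTheorem1 :
    (∃ c : ℝ, 0 < c ∧ 2.407 ≤ c ∧ c < 2.408 ∧
      Tendsto Sudler.Q atTop (𝓝 c) ∧
      Tendsto (fun n : ℕ => Sudler.P (Nat.fib n) Sudler.omega) atTop (𝓝 c)) ∧
    (∀ n : ℕ, 1 ≤ n → Sudler.Q n = Sudler.A n * Sudler.B n * Sudler.C n) ∧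
    Tendsto Sudler.A atTop (𝓝 (2 * Real.pi / Real.sqrt 5)) ∧
    (∃ b : ℝ, 0 < b ∧ Tendsto Sudler.B atTop (𝓝 b)) ∧
    (∃ d : ℝ, 0 < d ∧ Tendsto Sudler.C atTop (𝓝 d)) := by
  open Sudler in
  have hABC : ∀ n : ℕ, 1 ≤ n → Q n = A n * B n * C n := fun n hn => by
    obtain ⟨m, rfl⟩ : ∃ m, n = m + 1 := ⟨n - 1, by omega⟩
    exact Q_eq_A_mul_B_mul_C m
  have hQ : Tendsto Sudler.Q atTop (𝓝 (2 * Real.pi / Real.sqrt 5 *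
      (Real.exp (2 * (Sudler.remLim - Sudler.linLim)) * Real.exp Sudler.logCLim))) := by
    rw [← mul_assoc]
    refine ((Sudler.tendsto_A.mul Sudler.tendsto_B).mul Sudler.tendsto_C).congr' ?_
    filter_upwards [eventually_ge_atTop 1] with n hn
    exact (hABC n hn).symm
  obtain ⟨h1, h2⟩ := Sudler.limit_bounds (by positivity) Sudler.tendsto_G
  exact ⟨⟨_, by positivity, h1, h2, hQ, by simpa only [Sudler.P_fib_eq_Q] using hQ⟩, hABC,
    Sudler.tendsto_A, ⟨_, Real.exp_pos _, Sudler.tendsto_B⟩, ⟨_, Real.exp_pos _, Sudler.tendsto_C⟩⟩
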